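/- **Theorem (Second booleanization).** An *inverse semigroup* is a semigroup in which every $a$ has a unique $a^{-1}$ with $aa^{-1}a=a$ and $a^{-1}aa^{-1}=a^{-1}$. It is ordered by its natural partial order: $a\le b$ iff $a=be$ for some idempotent $e$. A minimum element for this order is called a *zero* (one need not exist). Elements $a,b$ are *compatible* if $a^{-1}b$ and $ab^{-1}$ are idempotent. An inverse semigroup is *distributive* if every finite compatible subset (including the empty set) has a join and multiplication distributes over the finite joins that exist; a *morphism* of distributive inverse semigroups is a semigroup homomorphism preserving joins of finite compatible subsets. A distributive inverse semigroup is *weakly boolean* if its idempotents form a boolean algebra, possibly without a top element. A *filter* is a nonempty, down-directed, upward closed subset containing no zero; it is *prime* if $a\vee b\in F$ implies $a\in F$ or $b\in F$. Let $S$ be an inverse semigroup. For a filter $F$ of $S$ put $F^{-1}=\{s^{-1}:s\in F\}$, $\mathbf d(F)=(F^{-1}F)^{\uparrow}$ and $\mathbf r(F)=(FF^{-1})^{\uparrow}$, where $A^{\uparrow}$ is the upward closure of $A$. The universal groupoid $\mathsf G_u(S)$ is the groupoid of all filters of $S$ with product $F\cdot G=(FG)^{\uparrow}$, defined when $\mathbf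 d(F)=\mathbf r(G)$, with the topology generated by the sets $$U_{x;x_1,\dots,x_n}=\{F : x\in F,\ x_1,\dots,x_n\notin F\},\qquad n\ge 0,\ x_1,\dots,x_n\le x .$$ A set $A\subseteq \mathsf G_u(S)$ is a *bisection* if $A^{-1}A$ and $AA^{-1}$ consist of identities. Let $\mathsf B(S)$ be the set of compact-open bisections of $\mathsf G_u(S)$; it is a distributive inverse semigroup under subset multiplication. Let $\beta\colon S\to\mathsf B(S)$ be the homomorphism $\beta(s)=U_s=\{F: s\in F\}$. Let $\theta\colon S\to T$ be a semigroup homomorphism to a weakly boolean inverse semigroup $T$ such that $\theta^{-1}(P)$ is a filter of $S$ for every prime filter $P$ of $T$. Then there is a unique morphism of distributive inverse semigroups $\bar\theta\colon \mathsf B(S)\to T$ such that $\bar\theta\circ\beta=\theta$. -/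

import Mathlib

/-- An inverse semigroup: a semigroup in which every element `a` has a unique generalized inverse
`a⁻¹`, that is, a unique element satisfying `a a⁻¹ a = a` and `a⁻¹ a a⁻¹ = a⁻¹`.
It may or may not have a zero. -/
class InverseSemigroup (S : Type*) extends Semigroup S, Inv S where
  mul_inv_mul : ∀ a : S, a * a⁻¹ * a = a
  inv_mul_inv : ∀ a : S, a⁻¹ * a * a⁻¹ = a⁻¹
  eq_inv_of : ∀ a b : S, a * b * a = a → b * a * b = b → b = a⁻¹

namespace InverseSemigroup

variable {S : Type*} [InverseSemigroup S]

theorem inv_inv' (a : S) : a⁻¹⁻¹ = a :=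
  (eq_inv_of _ _ (inv_mul_inv a) (mul_inv_mul a)).symm

theorem idem_inv {e : S} (he : IsIdempotentElem e) : e⁻¹ = e :=
  (eq_inv_of e e (by rw [he.eq, he.eq]) (by rw [he.eq, he.eq])).symm

theorem idem_mul {e f : S} (he : IsIdempotentElem e) (hf : IsIdempotentElem f) :
    IsIdempotentElem (e * f) := by
  have he' := he.eq
  have hf' := hf.eq
  have h1 := mul_inv_mul (e * f)
  have h2 := inv_mul_inv (e * f)
  generalize hx : (e * f)⁻¹ = x at h1 h2
  have h3 : f * x * e = x := by
    rw [← hx]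
    apply eq_inv_of
    · rw [hx]
      calc e * f * (f * x * e) * (e * f) = e * (f * f) * x * ((e * e) * f) := by
            simp only [mul_assoc]
        _ = e * f := by rw [he', hf', h1]
    · rw [hx]
      calc f * x * e * (e * f) * (f * x * e) = f * (x * ((e * e) * (f * f)) * x) * e := by
            simp only [mul_assoc]
        _ = f * x * e := by rw [he', hf', h2]
  have h4 : IsIdempotentElem x := by
    change x * x = x
    calc x * x = (f * x * e) * (f * x * e) := by rw [h3]
      _ = f * (x * (e * f) * x) * e := by simp only [mul_assoc]
      _ = x := by rw [h2, h3]
  have h5 : e * f = x := by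
    rw [← inv_inv' (e * f), hx, idem_inv h4]
  rwa [h5]

theorem idem_comm {e f : S} (he : IsIdempotentElem e) (hf : IsIdempotentElem f) :
    e * f = f * e := by
  have he' := he.eq
  have hf' := hf.eq
  have h1 := (idem_mul he hf).eq
  have h2 := (idem_mul hf he).eq
  have h3 : f * e = (e * f)⁻¹ := by
    apply eq_inv_of
    · calc e * f * (f * e) * (e * f) = e * (f * f) * ((e * e) * f) := by simp only [mul_assoc]
        _ = e * f := by rw [he', hf', h1]
    · calc f * e * (e * f) * (f * e) = f * (e * e) * ((f * f) * e) := by simp only [mul_assoc]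
        _ = f * e := by rw [he', hf', h2]
  rw [h3, idem_inv (idem_mul he hf)]

theorem idem_inv_mul (a : S) : IsIdempotentElem (a⁻¹ * a) := by
  change a⁻¹ * a * (a⁻¹ * a) = a⁻¹ * a
  rw [← mul_assoc, inv_mul_inv]

theorem idem_mul_inv (a : S) : IsIdempotentElem (a * a⁻¹) := by
  change a * a⁻¹ * (a * a⁻¹) = a * a⁻¹
  rw [← mul_assoc, mul_inv_mul]

theorem mul_inv_rev' (a b : S) : (a * b)⁻¹ = b⁻¹ * a⁻¹ := by
  symm
  apply eq_inv_of
  · calc a * b * (b⁻¹ * a⁻¹) * (a * b) = a * ((b * b⁻¹) * (a⁻¹ * a)) * b := by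
          simp only [mul_assoc]
      _ = (a * a⁻¹ * a) * (b * b⁻¹ * b) := by
          rw [idem_comm (idem_mul_inv b) (idem_inv_mul a)]; simp only [mul_assoc]
      _ = a * b := by rw [mul_inv_mul, mul_inv_mul]
  · calc b⁻¹ * a⁻¹ * (a * b) * (b⁻¹ * a⁻¹) = b⁻¹ * ((a⁻¹ * a) * (b * b⁻¹)) * a⁻¹ := by
          simp only [mul_assoc]
      _ = (b⁻¹ * b * b⁻¹) * (a⁻¹ * a * a⁻¹) := by
          rw [← idem_comm (idem_mul_inv b) (idem_inv_mul a)]; simp only [mul_assoc]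
      _ = b⁻¹ * a⁻¹ := by rw [inv_mul_inv, inv_mul_inv]

/-- The natural partial order: `a ≤ b` when `a = b e` for some idempotent `e`. -/
instance instPartialOrder : PartialOrder S where
  le a b := ∃ e, IsIdempotentElem e ∧ a = b * e
  le_refl a := ⟨a⁻¹ * a, idem_inv_mul a, by rw [← mul_assoc, mul_inv_mul]⟩
  le_trans := by
    rintro a b c ⟨e, he, rfl⟩ ⟨f, hf, rfl⟩
    exact ⟨f * e, idem_mul hf he, mul_assoc _ _ _⟩
  le_antisymm := by
    rintro a b ⟨e, he, h1⟩ ⟨f, hf, h2⟩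
    have h3 : a = a * f * e := by rw [← h2]; exact h1
    have h4 : a * f = a := by
      calc a * f = (a * f * e) * f := by rw [← h3]
        _ = a * (f * (e * f)) := by simp only [mul_assoc]
        _ = a * ((f * f) * e) := by rw [idem_comm he hf, mul_assoc]
        _ = a := by rw [hf.eq, ← mul_assoc, ← h3]
    rw [h2, h4]

theorem le_def {a b : S} : a ≤ b ↔ ∃ e, IsIdempotentElem e ∧ a = b * e := Iff.rfl


theorem le_iff_right {a b : S} : a ≤ b ↔ a = b * (a⁻¹ * a) := by
  refine ⟨?_, fun h => ⟨_, idem_inv_mul a, h⟩⟩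
  rintro ⟨e, he, rfl⟩
  rw [mul_inv_rev', idem_inv he]
  calc b * e = (b * b⁻¹ * b) * (e * e) := by rw [mul_inv_mul, he.eq]
    _ = b * ((b⁻¹ * b) * e) * e := by simp only [mul_assoc]
    _ = b * (e * b⁻¹ * (b * e)) := by
      rw [idem_comm (idem_inv_mul b) he]; simp only [mul_assoc]

theorem idem_conj (b : S) {e : S} (he : IsIdempotentElem e) :
    IsIdempotentElem (b * e * b⁻¹) := by
  have h := idem_mul_inv (b * e)
  rw [mul_inv_rev', idem_inv he] at h
  have : b * e * (e * b⁻¹) = b * (e * e) * b⁻¹ := by simp only [mul_assoc]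
  rwa [this, he.eq] at h

theorem le_of_left {a b f : S} (hf : IsIdempotentElem f) (h : a = f * b) : a ≤ b := by
  refine ⟨b⁻¹ * f * b, ?_, ?_⟩
  · have := idem_conj b⁻¹ hf
    rwa [inv_inv'] at this
  · calc a = f * (b * b⁻¹ * b) := by rw [mul_inv_mul, h]
      _ = (f * (b * b⁻¹)) * b := by simp only [mul_assoc]
      _ = b * (b⁻¹ * f * b) := by
        rw [idem_comm hf (idem_mul_inv b)]; simp only [mul_assoc]

theorem exists_left {a b : S} (h : a ≤ b) : ∃ f, IsIdempotentElem f ∧ a = f * b := by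
  obtain ⟨e, he, rfl⟩ := h
  refine ⟨b * e * b⁻¹, idem_conj b he, ?_⟩
  calc b * e = (b * b⁻¹ * b) * e := by rw [mul_inv_mul]
    _ = b * ((b⁻¹ * b) * e) := by simp only [mul_assoc]
    _ = b * e * b⁻¹ * b := by rw [idem_comm (idem_inv_mul b) he]; simp only [mul_assoc]

theorem inv_le_inv' {a b : S} (h : a ≤ b) : a⁻¹ ≤ b⁻¹ := by
  obtain ⟨e, he, rfl⟩ := h
  rw [mul_inv_rev', idem_inv he]
  exact le_of_left he rfl

theorem mul_le_mul'' {a b c d : S} (h : a ≤ b) (h' : c ≤ d) : a * c ≤ b * d := by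
  have h1 : a * c ≤ b * c := by
    obtain ⟨f, hf, rfl⟩ := exists_left h
    exact le_of_left hf (mul_assoc _ _ _)
  have h2 : b * c ≤ b * d := by
    obtain ⟨f, hf, rfl⟩ := h'
    exact ⟨f, hf, (mul_assoc _ _ _).symm⟩
  exact h1.trans h2

theorem mul_idem_le (a : S) {e : S} (he : IsIdempotentElem e) : a * e ≤ a := ⟨e, he, rfl⟩

theorem idem_mul_le (a : S) {e : S} (he : IsIdempotentElem e) : e * a ≤ a := le_of_left he rfl

theorem idem_of_le {a e : S} (he : IsIdempotentElem e) (h : a ≤ e) : IsIdempotentElem a := by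
  obtain ⟨f, hf, rfl⟩ := h
  exact idem_mul he hf

/-- For idempotents, `e ≤ f` means `f e = e`. -/
theorem idem_le {e f : S} (he : IsIdempotentElem e) (h : e ≤ f) : f * e = e := by
  have := le_iff_right.1 h
  rw [idem_inv he, he.eq] at this
  exact this.symm

theorem le_iff_left {a b : S} : a ≤ b ↔ a = a * a⁻¹ * b := by
  refine ⟨fun h => ?_, fun h => le_of_left (idem_mul_inv a) h⟩
  have h1 := le_iff_right.1 (inv_le_inv' h)
  rw [inv_inv'] at h1
  have h2 := congrArg (fun t => t⁻¹) h1
  simp only [mul_inv_rev', inv_inv'] at h2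
  exact h2

theorem isBot_mul {z : S} (hz : IsBot z) (a : S) : z * a = z ∧ a * z = z := by
  have hid : IsIdempotentElem z := idem_of_le (idem_inv_mul z) (hz _)
  have h1 := le_iff_right.1 (hz a)
  have h2 := le_iff_left.1 (hz a)
  rw [idem_inv hid, hid.eq] at h1 h2
  exact ⟨h2.symm, h1.symm⟩

theorem isBot_of_le {y z : S} (hz : IsBot z) (h : y ≤ z) : IsBot y := fun b => h.trans (hz b)

/-- Two elements below `x` have the meet `a b⁻¹ b`. -/
theorem meet_below {a b x : S} (ha : a ≤ x) (hb : b ≤ x) :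
    a * (b⁻¹ * b) ≤ a ∧ a * (b⁻¹ * b) ≤ b ∧
      ∀ c, c ≤ a → c ≤ b → c ≤ a * (b⁻¹ * b) := by
  refine ⟨mul_idem_le _ (idem_inv_mul b), ?_, ?_⟩
  · have h1 := le_iff_right.1 ha
    have h2 := le_iff_right.1 hb
    have h3 : a * (b⁻¹ * b) = b * (a⁻¹ * a) := by
      calc a * (b⁻¹ * b) = x * (a⁻¹ * a) * (b⁻¹ * b) := by rw [← h1]
        _ = x * (b⁻¹ * b) * (a⁻¹ * a) := by
          rw [mul_assoc, idem_comm (idem_inv_mul a) (idem_inv_mul b), ← mul_assoc]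
        _ = b * (a⁻¹ * a) := by rw [← h2]
    rw [h3]
    exact mul_idem_le _ (idem_inv_mul a)
  · intro c hca hcb
    have h1 := le_iff_right.1 hca
    have h2 : c⁻¹ * c ≤ b⁻¹ * b := mul_le_mul'' (inv_le_inv' hcb) hcb
    rw [h1]
    exact mul_le_mul'' le_rfl h2

/-- Elements `a` and `b` are compatible if `a⁻¹ b` and `a b⁻¹` are both idempotent. -/
def Compatible (a b : S) : Prop := IsIdempotentElem (a⁻¹ * b) ∧ IsIdempotentElem (a * b⁻¹)

theorem Compatible.of_le {a b c : S} (ha : a ≤ c) (hb : b ≤ c) : Compatible a b :=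
  ⟨idem_of_le (idem_inv_mul c) (mul_le_mul'' (inv_le_inv' ha) hb),
    idem_of_le (idem_mul_inv c) (mul_le_mul'' ha (inv_le_inv' hb))⟩

end InverseSemigroup

open InverseSemigroup in
/-- A distributive inverse semigroup: all finite compatible subsets (including the empty one) have
joins, and multiplication distributes over the finite joins that exist. -/
class IsDistributive (S : Type*) [InverseSemigroup S] : Prop where
  exists_isLUB : ∀ A : Set S, A.Finite → (∀ a ∈ A, ∀ b ∈ A, Compatible a b) → ∃ s, IsLUB A s
  mul_isLUB : ∀ (A : Set S) (s c : S), A.Finite → IsLUB A s →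
    IsLUB ((fun a => c * a) '' A) (c * s)
  isLUB_mul : ∀ (A : Set S) (s c : S), A.Finite → IsLUB A s →
    IsLUB ((fun a => a * c) '' A) (s * c)

/-- A weakly boolean inverse semigroup: a distributive inverse semigroup whose idempotents form
a boolean algebra, possibly without a top element. In a distributive inverse semigroup the
idempotents form a distributive lattice with a zero, in which the meet of `e` and `f` is `e * f`;
it is boolean exactly when every `f ≤ e` has a relative complement `g` in `e`. -/
class IsWeaklyBoolean (S : Type*) [InverseSemigroup S] : Prop extends IsDistributive S where
  exists_compl : ∀ e f : S, IsIdempotentElem e → IsIdempotentElem f → f ≤ e →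
    ∃ g : S, IsIdempotentElem g ∧ IsLUB {f, g} e ∧ IsBot (f * g)

open InverseSemigroup in
/-- A morphism of distributive inverse semigroups: a semigroup homomorphism that preserves the
joins of finite compatible subsets. -/
structure DistributiveHom (S T : Type*) [InverseSemigroup S] [InverseSemigroup T]
    [IsDistributive S] [IsDistributive T] extends S →ₙ* T where
  map_isLUB : ∀ (A : Set S) (s : S), A.Finite → (∀ a ∈ A, ∀ b ∈ A, Compatible a b) →
    IsLUB A s → IsLUB (toFun '' A) (toFun s)

/-- A proper filter of an inverse semigroup: a nonempty, downward directed, upward closed subset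
for the natural partial order that does not contain a zero (a minimum element). -/
structure IsProperFilter {S : Type*} [InverseSemigroup S] (F : Set S) : Prop where
  nonempty : F.Nonempty
  directedOn : DirectedOn (· ≥ ·) F
  isUpperSet : IsUpperSet F
  not_isBot : ∀ z ∈ F, ¬ IsBot z

/-- A prime filter: a proper filter such that if a join `a ∨ b` lies in it then so does
`a` or `b`. -/
structure IsPrimeFilter {S : Type*} [InverseSemigroup S] (F : Set S) : Prop
    extends IsProperFilter F where
  prime : ∀ a b c : S, IsLUB {a, b} c → c ∈ F → a ∈ F ∨ b ∈ F

/-- The points of the universal groupoid of `S`: the proper filters of `S`. -/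
structure UniversalGroupoid (S : Type*) [InverseSemigroup S] where
  carrier : Set S
  isProperFilter : IsProperFilter carrier

namespace UniversalGroupoid

open InverseSemigroup

variable {S : Type*} [InverseSemigroup S]

instance : SetLike (UniversalGroupoid S) S where
  coe F := F.carrier
  coe_injective F G h := by cases F; cases G; congr

@[ext] theorem ext {F G : UniversalGroupoid S} (h : ∀ s, s ∈ F ↔ s ∈ G) : F = G :=
  SetLike.ext h

theorem nonempty (F : UniversalGroupoid S) : ∃ s, s ∈ F := F.isProperFilter.nonempty

theorem up (F : UniversalGroupoid S) {a b : S} (h : a ≤ b) (ha : a ∈ F) : b ∈ F :=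
  F.isProperFilter.isUpperSet h ha

theorem dir (F : UniversalGroupoid S) {a b : S} (ha : a ∈ F) (hb : b ∈ F) :
    ∃ c ∈ F, c ≤ a ∧ c ≤ b :=
  F.isProperFilter.directedOn a ha b hb

theorem not_bot (F : UniversalGroupoid S) {a : S} (ha : a ∈ F) : ¬ IsBot a :=
  F.isProperFilter.not_isBot a ha

theorem isProperFilter_of {F : Set S} (h1 : ∃ a, a ∈ F)
    (h2 : ∀ a ∈ F, ∀ b ∈ F, ∃ c ∈ F, c ≤ a ∧ c ≤ b)
    (h3 : ∀ a b, a ≤ b → a ∈ F → b ∈ F) (h4 : ∀ z ∈ F, ¬ IsBot z) : IsProperFilter F :=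
  ⟨h1, h2, fun a b => h3 a b, h4⟩

/-- The inverse filter `F⁻¹ = {s⁻¹ : s ∈ F}`. -/
def inv (F : UniversalGroupoid S) : UniversalGroupoid S where
  carrier := {s | s⁻¹ ∈ F}
  isProperFilter := by
    refine isProperFilter_of ?_ ?_ ?_ ?_
    · obtain ⟨a, ha⟩ := F.nonempty
      exact ⟨a⁻¹, by simpa [inv_inv'] using ha⟩
    · intro a ha b hb
      obtain ⟨c, hc, h1, h2⟩ := F.dir ha hb
      refine ⟨c⁻¹, by simpa [inv_inv'] using hc, ?_, ?_⟩
      · simpa [inv_inv'] using inv_le_inv' h1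
      · simpa [inv_inv'] using inv_le_inv' h2
    · intro a b h ha
      exact F.up (inv_le_inv' h) ha
    · intro z hz hb
      refine F.not_bot hz (fun b => ?_)
      have := inv_le_inv' (hb b⁻¹)
      rwa [inv_inv'] at this

/-- The domain `𝐝(F) = (F⁻¹F)^↑`. -/
def dom (F : UniversalGroupoid S) : UniversalGroupoid S where
  carrier := {s | ∃ a ∈ F, ∃ b ∈ F, a⁻¹ * b ≤ s}
  isProperFilter := by
    refine isProperFilter_of ?_ ?_ ?_ ?_
    · obtain ⟨a, ha⟩ := F.nonempty
      exact ⟨_, a, ha, a, ha, le_rfl⟩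
    · rintro s ⟨a, ha, b, hb, h⟩ t ⟨a', ha', b', hb', h'⟩
      obtain ⟨c, hc, h1, h2⟩ := F.dir ha ha'
      obtain ⟨d, hd, h3, h4⟩ := F.dir hb hb'
      exact ⟨c⁻¹ * d, ⟨c, hc, d, hd, le_rfl⟩, (mul_le_mul'' (inv_le_inv' h1) h3).trans h,
        (mul_le_mul'' (inv_le_inv' h2) h4).trans h'⟩
    · rintro s t hst ⟨a, ha, b, hb, h⟩
      exact ⟨a, ha, b, hb, h.trans hst⟩
    · rintro z ⟨a, ha, b, hb, h⟩ hz
      obtain ⟨c, hc, h1, h2⟩ := F.dir ha hb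
      have h3 : IsBot (c⁻¹ * c) :=
        isBot_of_le hz ((mul_le_mul'' (inv_le_inv' h1) h2).trans h)
      have h4 := (isBot_mul h3 c).2
      rw [← mul_assoc, mul_inv_mul] at h4
      exact F.not_bot hc (h4 ▸ h3)

/-- The range `𝐫(F) = (FF⁻¹)^↑`. -/
def ran (F : UniversalGroupoid S) : UniversalGroupoid S where
  carrier := {s | ∃ a ∈ F, ∃ b ∈ F, a * b⁻¹ ≤ s}
  isProperFilter := by
    refine isProperFilter_of ?_ ?_ ?_ ?_
    · obtain ⟨a, ha⟩ := F.nonempty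
      exact ⟨_, a, ha, a, ha, le_rfl⟩
    · rintro s ⟨a, ha, b, hb, h⟩ t ⟨a', ha', b', hb', h'⟩
      obtain ⟨c, hc, h1, h2⟩ := F.dir ha ha'
      obtain ⟨d, hd, h3, h4⟩ := F.dir hb hb'
      exact ⟨c * d⁻¹, ⟨c, hc, d, hd, le_rfl⟩, (mul_le_mul'' h1 (inv_le_inv' h3)).trans h,
        (mul_le_mul'' h2 (inv_le_inv' h4)).trans h'⟩
    · rintro s t hst ⟨a, ha, b, hb, h⟩
      exact ⟨a, ha, b, hb, h.trans hst⟩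
    · rintro z ⟨a, ha, b, hb, h⟩ hz
      obtain ⟨c, hc, h1, h2⟩ := F.dir ha hb
      have h3 : IsBot (c * c⁻¹) :=
        isBot_of_le hz ((mul_le_mul'' h1 (inv_le_inv' h2)).trans h)
      have h4 := (isBot_mul h3 c).1
      rw [mul_inv_mul] at h4
      exact F.not_bot hc (h4 ▸ h3)

theorem mem_inv {F : UniversalGroupoid S} {s : S} : s ∈ F.inv ↔ s⁻¹ ∈ F := Iff.rfl

theorem inv_mem_inv {F : UniversalGroupoid S} {s : S} (h : s ∈ F) : s⁻¹ ∈ F.inv := by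
  rwa [mem_inv, inv_inv']

theorem mem_dom {F : UniversalGroupoid S} {s : S} : s ∈ F.dom ↔ ∃ a ∈ F, a⁻¹ * a ≤ s := by
  constructor
  · rintro ⟨a, ha, b, hb, h⟩
    obtain ⟨c, hc, h1, h2⟩ := F.dir ha hb
    exact ⟨c, hc, (mul_le_mul'' (inv_le_inv' h1) h2).trans h⟩
  · rintro ⟨a, ha, h⟩
    exact ⟨a, ha, a, ha, h⟩

theorem mem_ran {F : UniversalGroupoid S} {s : S} : s ∈ F.ran ↔ ∃ a ∈ F, a * a⁻¹ ≤ s := by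
  constructor
  · rintro ⟨a, ha, b, hb, h⟩
    obtain ⟨c, hc, h1, h2⟩ := F.dir ha hb
    exact ⟨c, hc, (mul_le_mul'' h1 (inv_le_inv' h2)).trans h⟩
  · rintro ⟨a, ha, h⟩
    exact ⟨a, ha, a, ha, h⟩

theorem mul_dom_mem {F : UniversalGroupoid S} {a s : S} (ha : a ∈ F) (hs : s ∈ F.dom) :
    a * s ∈ F := by
  obtain ⟨b, hb, h⟩ := mem_dom.1 hs
  obtain ⟨c, hc, h1, h2⟩ := F.dir ha hb
  refine F.up ?_ hc
  calc c = c * (c⁻¹ * c) := by rw [← mul_assoc, mul_inv_mul]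
    _ ≤ a * s := mul_le_mul'' h1 ((mul_le_mul'' (inv_le_inv' h2) h2).trans h)

theorem ran_mul_mem {F : UniversalGroupoid S} {a s : S} (ha : a ∈ F) (hs : s ∈ F.ran) :
    s * a ∈ F := by
  obtain ⟨b, hb, h⟩ := mem_ran.1 hs
  obtain ⟨c, hc, h1, h2⟩ := F.dir ha hb
  refine F.up ?_ hc
  calc c = c * c⁻¹ * c := by rw [mul_inv_mul]
    _ ≤ s * a := mul_le_mul'' ((mul_le_mul'' h2 (inv_le_inv' h2)).trans h) h1

/-- The groupoid product `F · G = (FG)^↑`, defined when `𝐝(F) = 𝐫(G)`. -/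
def mul (F G : UniversalGroupoid S) (hFG : F.dom = G.ran) : UniversalGroupoid S where
  carrier := {s | ∃ a ∈ F, ∃ b ∈ G, a * b ≤ s}
  isProperFilter := by
    refine isProperFilter_of ?_ ?_ ?_ ?_
    · obtain ⟨a, ha⟩ := F.nonempty
      obtain ⟨b, hb⟩ := G.nonempty
      exact ⟨_, a, ha, b, hb, le_rfl⟩
    · rintro s ⟨a, ha, b, hb, h⟩ t ⟨a', ha', b', hb', h'⟩
      obtain ⟨c, hc, h1, h2⟩ := F.dir ha ha'
      obtain ⟨d, hd, h3, h4⟩ := G.dir hb hb'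
      exact ⟨c * d, ⟨c, hc, d, hd, le_rfl⟩, (mul_le_mul'' h1 h3).trans h,
        (mul_le_mul'' h2 h4).trans h'⟩
    · rintro s t hst ⟨a, ha, b, hb, h⟩
      exact ⟨a, ha, b, hb, h.trans hst⟩
    · rintro z ⟨a, ha, b, hb, h⟩ hz
      have h1 : a⁻¹ * a ∈ G.ran := hFG ▸ mem_dom.2 ⟨a, ha, le_rfl⟩
      have h2 := ran_mul_mem hb h1
      have h3 : IsBot (a * b) := isBot_of_le hz h
      rw [mul_assoc, (isBot_mul h3 _).2] at h2
      exact G.not_bot h2 h3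

theorem mem_mul {F G : UniversalGroupoid S} {h : F.dom = G.ran} {s : S} :
    s ∈ F.mul G h ↔ ∃ a ∈ F, ∃ b ∈ G, a * b ≤ s := Iff.rfl

theorem mul_mem_mul {F G : UniversalGroupoid S} (h : F.dom = G.ran) {a b : S} (ha : a ∈ F)
    (hb : b ∈ G) : a * b ∈ F.mul G h := ⟨a, ha, b, hb, le_rfl⟩

theorem inv_inv_eq (F : UniversalGroupoid S) : F.inv.inv = F := by
  ext s; simp [mem_inv, inv_inv']

theorem dom_inv (F : UniversalGroupoid S) : F.inv.dom = F.ran := by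
  ext s
  rw [mem_dom, mem_ran]
  constructor
  · rintro ⟨a, ha, h⟩
    exact ⟨a⁻¹, ha, by rwa [inv_inv']⟩
  · rintro ⟨a, ha, h⟩
    exact ⟨a⁻¹, inv_mem_inv ha, by rwa [inv_inv']⟩

theorem ran_inv (F : UniversalGroupoid S) : F.inv.ran = F.dom := by
  rw [← dom_inv, inv_inv_eq]

theorem dom_mul (F G : UniversalGroupoid S) (h : F.dom = G.ran) : (F.mul G h).dom = G.dom := by
  ext s
  rw [mem_dom, mem_dom]
  constructor
  · rintro ⟨t, ⟨a, ha, b, hb, hab⟩, hs⟩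
    have h1 : a⁻¹ * a ∈ G.ran := h ▸ mem_dom.2 ⟨a, ha, le_rfl⟩
    refine ⟨_, ran_mul_mem hb h1, le_trans ?_ hs⟩
    calc (a⁻¹ * a * b)⁻¹ * (a⁻¹ * a * b) = b⁻¹ * ((a⁻¹ * a) * (a⁻¹ * a)) * b := by
          rw [mul_inv_rev', idem_inv (idem_inv_mul a)]; simp only [mul_assoc]
      _ = (a * b)⁻¹ * (a * b) := by
          rw [(idem_inv_mul a).eq, mul_inv_rev']; simp only [mul_assoc]
      _ ≤ t⁻¹ * t := mul_le_mul'' (inv_le_inv' hab) hab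
  · rintro ⟨b, hb, hs⟩
    obtain ⟨a, ha⟩ := F.nonempty
    refine ⟨_, mul_mem_mul h ha hb, le_trans ?_ hs⟩
    calc (a * b)⁻¹ * (a * b) = b⁻¹ * ((a⁻¹ * a) * b) := by
          rw [mul_inv_rev']; simp only [mul_assoc]
      _ ≤ b⁻¹ * b := mul_le_mul'' le_rfl (idem_mul_le _ (idem_inv_mul a))

theorem ran_mul (F G : UniversalGroupoid S) (h : F.dom = G.ran) : (F.mul G h).ran = F.ran := by
  ext s
  rw [mem_ran, mem_ran]
  constructor
  · rintro ⟨t, ⟨a, ha, b, hb, hab⟩, hs⟩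
    have h1 : b * b⁻¹ ∈ F.dom := h ▸ mem_ran.2 ⟨b, hb, le_rfl⟩
    refine ⟨_, mul_dom_mem ha h1, le_trans ?_ hs⟩
    calc (a * (b * b⁻¹)) * (a * (b * b⁻¹))⁻¹ = a * ((b * b⁻¹) * (b * b⁻¹)) * a⁻¹ := by
          rw [mul_inv_rev', idem_inv (idem_mul_inv b)]; simp only [mul_assoc]
      _ = (a * b) * (a * b)⁻¹ := by
          rw [(idem_mul_inv b).eq, mul_inv_rev']; simp only [mul_assoc]
      _ ≤ t * t⁻¹ := mul_le_mul'' hab (inv_le_inv' hab)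
  · rintro ⟨a, ha, hs⟩
    obtain ⟨b, hb⟩ := G.nonempty
    refine ⟨_, mul_mem_mul h ha hb, le_trans ?_ hs⟩
    calc (a * b) * (a * b)⁻¹ = (a * (b * b⁻¹)) * a⁻¹ := by
          rw [mul_inv_rev']; simp only [mul_assoc]
      _ ≤ a * a⁻¹ := mul_le_mul'' (mul_idem_le _ (idem_mul_inv b)) le_rfl

theorem mul_assoc' (F G H : UniversalGroupoid S) (h1 : F.dom = G.ran)
    (h2 : (F.mul G h1).dom = H.ran) (h3 : G.dom = H.ran) (h4 : F.dom = (G.mul H h3).ran) :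
    (F.mul G h1).mul H h2 = F.mul (G.mul H h3) h4 := by
  ext s
  constructor
  · rintro ⟨t, ⟨a, ha, b, hb, hab⟩, c, hc, hs⟩
    refine ⟨a, ha, _, mul_mem_mul h3 hb hc, le_trans ?_ hs⟩
    rw [← mul_assoc]
    exact mul_le_mul'' hab le_rfl
  · rintro ⟨a, ha, t, ⟨b, hb, c, hc, hbc⟩, hs⟩
    refine ⟨_, mul_mem_mul h1 ha hb, c, hc, le_trans ?_ hs⟩
    rw [mul_assoc]
    exact mul_le_mul'' le_rfl hbc

theorem dom_mem_sub {F : UniversalGroupoid S} {a : S} (ha : a ∈ F) : a⁻¹ * a ∈ F.dom :=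
  mem_dom.2 ⟨a, ha, le_rfl⟩

theorem ran_mem_sub {F : UniversalGroupoid S} {a : S} (ha : a ∈ F) : a * a⁻¹ ∈ F.ran :=
  mem_ran.2 ⟨a, ha, le_rfl⟩

theorem inv_mul_self (F : UniversalGroupoid S) (h : F.inv.dom = F.ran) :
    F.inv.mul F h = F.dom := by
  ext s
  rw [mem_dom]
  constructor
  · rintro ⟨a, ha, b, hb, hs⟩
    obtain ⟨c, hc, h1, h2⟩ := F.dir ha hb
    refine ⟨c, hc, le_trans (mul_le_mul'' ?_ h2) hs⟩
    simpa [inv_inv'] using inv_le_inv' h1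
  · rintro ⟨a, ha, hs⟩
    exact ⟨_, inv_mem_inv ha, a, ha, hs⟩

theorem mul_inv_self (F : UniversalGroupoid S) (h : F.dom = F.inv.ran) :
    F.mul F.inv h = F.ran := by
  ext s
  rw [mem_ran]
  constructor
  · rintro ⟨a, ha, b, hb, hs⟩
    obtain ⟨c, hc, h1, h2⟩ := F.dir ha hb
    refine ⟨c, hc, le_trans (mul_le_mul'' h1 ?_) hs⟩
    simpa [inv_inv'] using inv_le_inv' h2
  · rintro ⟨a, ha, hs⟩
    exact ⟨a, ha, _, inv_mem_inv ha, hs⟩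

theorem dom_dom (F : UniversalGroupoid S) : F.dom.dom = F.dom := by
  have h := dom_mul F.inv F (dom_inv F)
  rwa [inv_mul_self] at h

theorem ran_dom (F : UniversalGroupoid S) : F.dom.ran = F.dom := by
  have h := ran_mul F.inv F (dom_inv F)
  rwa [inv_mul_self, ran_inv] at h

theorem ran_ran (F : UniversalGroupoid S) : F.ran.ran = F.ran := by
  have h := ran_dom F.inv
  rwa [dom_inv] at h

theorem dom_ran (F : UniversalGroupoid S) : F.ran.dom = F.ran := by
  have h := dom_dom F.inv
  rwa [dom_inv] at h

theorem mul_dom_self (F G : UniversalGroupoid S) (h : F.dom = G.ran) (hG : G = F.dom) :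
    F.mul G h = F := by
  subst hG
  ext s
  constructor
  · rintro ⟨a, ha, b, hb, hs⟩
    exact F.up hs (mul_dom_mem ha hb)
  · intro hs
    refine ⟨s, hs, _, dom_mem_sub hs, ?_⟩
    rw [← mul_assoc, mul_inv_mul]

theorem ran_mul_self (F G : UniversalGroupoid S) (h : G.dom = F.ran) (hG : G = F.ran) :
    G.mul F h = F := by
  subst hG
  ext s
  constructor
  · rintro ⟨a, ha, b, hb, hs⟩
    exact F.up hs (ran_mul_mem hb ha)
  · intro hs
    refine ⟨_, ran_mem_sub hs, s, hs, ?_⟩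
    rw [mul_inv_mul]

/-- Filters with the same domain and a common element are equal. -/
theorem eq_of_dom_eq {F G : UniversalGroupoid S} (h : F.dom = G.dom) {a : S} (ha : a ∈ F)
    (hb : a ∈ G) : F = G := by
  have key : ∀ {F G : UniversalGroupoid S}, F.dom = G.dom → a ∈ F → a ∈ G →
      ∀ s ∈ F, s ∈ G := by
    intro F G h ha hb s hs
    obtain ⟨c, hc, h1, h2⟩ := F.dir ha hs
    have h3 : a * (c⁻¹ * c) ∈ G := mul_dom_mem hb (h ▸ dom_mem_sub hc)
    rw [← le_iff_right.1 h1] at h3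
    exact G.up h2 h3
  ext s
  exact ⟨key h ha hb s, key h.symm hb ha s⟩

theorem eq_of_ran_eq {F G : UniversalGroupoid S} (h : F.ran = G.ran) {a : S} (ha : a ∈ F)
    (hb : a ∈ G) : F = G := by
  have h1 : F.inv = G.inv :=
    eq_of_dom_eq (by rw [dom_inv, dom_inv, h]) (inv_mem_inv ha) (inv_mem_inv hb)
  rw [← inv_inv_eq F, h1, inv_inv_eq]

/-- The set of identities of the groupoid: the elements of the form `X · X⁻¹ = 𝐫(X)`. -/
def identities (S : Type*) [InverseSemigroup S] : Set (UniversalGroupoid S) :=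
  {F | ∃ X : UniversalGroupoid S, F = X.ran}

theorem identity_eq {F : UniversalGroupoid S} (h : F ∈ identities S) :
    F = F.dom ∧ F = F.ran := by
  obtain ⟨X, rfl⟩ := h
  exact ⟨(dom_ran X).symm, (ran_ran X).symm⟩

theorem dom_mem_identities (F : UniversalGroupoid S) : F.dom ∈ identities S :=
  ⟨F.inv, (ran_inv F).symm⟩

/-- The product of two sets of elements of the groupoid: all products that are defined. -/
def setMul (A B : Set (UniversalGroupoid S)) : Set (UniversalGroupoid S) :=
  {H | ∃ F ∈ A, ∃ G ∈ B, ∃ h : F.dom = G.ran, H = F.mul G h}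

/-- The set of inverses of the elements of a set. -/
def setInv (A : Set (UniversalGroupoid S)) : Set (UniversalGroupoid S) := inv '' A

/-- A (local) bisection: a set `A` such that `A⁻¹A` and `AA⁻¹` consist of identities. -/
def IsBisection (A : Set (UniversalGroupoid S)) : Prop :=
  setMul (setInv A) A ⊆ identities S ∧ setMul A (setInv A) ⊆ identities S

theorem mem_setInv {A : Set (UniversalGroupoid S)} {F : UniversalGroupoid S} :
    F ∈ setInv A ↔ F.inv ∈ A := by
  constructor
  · rintro ⟨G, hG, rfl⟩
    rwa [inv_inv_eq]
  · intro h
    exact ⟨_, h, inv_inv_eq F⟩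

theorem setInv_setInv (A : Set (UniversalGroupoid S)) : setInv (setInv A) = A := by
  ext F
  rw [mem_setInv, mem_setInv, inv_inv_eq]

theorem eq_of_mul_inv_identity {F G : UniversalGroupoid S} (h : F.dom = G.inv.ran)
    (hi : F.mul G.inv h ∈ identities S) : F = G := by
  have h1 : F.mul G.inv h = F.ran := by rw [(identity_eq hi).2, ran_mul]
  have h2 : F.mul G.inv h = G.ran := by rw [(identity_eq hi).1, dom_mul, dom_inv]
  obtain ⟨a, ha⟩ := F.nonempty
  have h3 : a * a⁻¹ ∈ F.mul G.inv h := h1 ▸ ran_mem_sub ha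
  obtain ⟨b, hb, c, hc, hbc⟩ := h3
  have h4 : b * c * c⁻¹ ∈ G := ran_mul_mem hc (h2 ▸ mul_mem_mul h hb hc)
  have h5 : c * c⁻¹ ∈ F.dom := h ▸ ran_mem_sub hc
  have h6 : b * c * c⁻¹ ∈ F := by
    rw [mul_assoc]
    exact mul_dom_mem hb h5
  exact eq_of_dom_eq (by rw [h, ran_inv]) h6 h4

theorem isBisection_iff {A : Set (UniversalGroupoid S)} :
    IsBisection A ↔ (∀ F ∈ A, ∀ G ∈ A, F.dom = G.dom → F = G) ∧
      (∀ F ∈ A, ∀ G ∈ A, F.ran = G.ran → F = G) := by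
  constructor
  · rintro ⟨h1, h2⟩
    refine ⟨fun F hF G hG h => ?_, fun F hF G hG h => ?_⟩
    · have h' : F.dom = G.inv.ran := by rw [h, ran_inv]
      exact eq_of_mul_inv_identity h' (h2 ⟨F, hF, G.inv, ⟨G, hG, rfl⟩, h', rfl⟩)
    · have h' : F.inv.dom = G.inv.inv.ran := by rw [dom_inv, inv_inv_eq, h]
      have h3 : F.inv.mul G.inv.inv h' ∈ identities S :=
        h1 ⟨F.inv, ⟨F, hF, rfl⟩, G.inv.inv, by rwa [inv_inv_eq], h', rfl⟩
      have h4 := eq_of_mul_inv_identity h' h3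
      rw [← inv_inv_eq F, h4, inv_inv_eq]
  · rintro ⟨h1, h2⟩
    constructor
    · rintro _ ⟨_, ⟨F, hF, rfl⟩, G, hG, h, rfl⟩
      have : F = G := h2 F hF G hG (by rw [← h, dom_inv])
      subst this
      rw [inv_mul_self]
      exact dom_mem_identities F
    · rintro _ ⟨F, hF, _, ⟨G, hG, rfl⟩, h, rfl⟩
      have : F = G := h1 F hF G hG (by rw [h, ran_inv])
      subst this
      rw [mul_inv_self]
      exact ⟨F, rfl⟩

/-- The set `U_{x;X}` of all proper filters that contain `x` and omit every element of `X`. -/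
def basicSet (x : S) (X : Set S) : Set (UniversalGroupoid S) :=
  {F | x ∈ F ∧ ∀ y ∈ X, y ∉ F}

/-- The patch topology: it is generated by the sets `U_{x;x₁,…,xₙ}`, where `x₁, …, xₙ ≤ x`. -/
instance : TopologicalSpace (UniversalGroupoid S) :=
  TopologicalSpace.generateFrom
    {U | ∃ (x : S) (X : Set S), X.Finite ∧ (∀ y ∈ X, y ≤ x) ∧ U = basicSet x X}

/-- The data `(x, X)` for which `U_{x;X}` is a basic open set. -/
abbrev BasicIndex (S : Type*) [InverseSemigroup S] : Type _ :=
  {p : S × Set S // p.2.Finite ∧ ∀ y ∈ p.2, y ≤ p.1}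

theorem isTopologicalBasis_basicSet :
    TopologicalSpace.IsTopologicalBasis
      (Set.range fun p : BasicIndex S => basicSet p.1.1 p.1.2) where
  exists_subset_inter := by
    rintro _ ⟨⟨⟨x, X⟩, hX, hx⟩, rfl⟩ _ ⟨⟨⟨y, Y⟩, hY, hy⟩, rfl⟩ F ⟨⟨h1, h2⟩, h3, h4⟩
    obtain ⟨z, hz, hzx, hzy⟩ := F.dir h1 h3
    have key : ∀ x w : S, z ≤ x → w ≤ x → z * (w⁻¹ * w) ≤ w := fun x w h h' =>
      (meet_below h h').2.1
    refine ⟨_, ⟨⟨(z, (fun w => z * (w⁻¹ * w)) '' (X ∪ Y)), (hX.union hY).image _, ?_⟩, rfl⟩,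
      ⟨hz, ?_⟩, ?_⟩
    · rintro _ ⟨w, -, rfl⟩
      exact mul_idem_le _ (idem_inv_mul w)
    · rintro _ ⟨w, hw | hw, rfl⟩ h
      · exact h2 w hw (F.up (key x w hzx (hx w hw)) h)
      · exact h4 w hw (F.up (key y w hzy (hy w hw)) h)
    · rintro G ⟨hzG, hG⟩
      have key2 : ∀ w, w ∈ X ∪ Y → w ∉ G := fun w hw hwG =>
        hG _ ⟨w, hw, rfl⟩ (mul_dom_mem hzG (dom_mem_sub hwG))
      exact ⟨⟨G.up hzx hzG, fun w hw => key2 w (Or.inl hw)⟩,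
        ⟨G.up hzy hzG, fun w hw => key2 w (Or.inr hw)⟩⟩
  sUnion_eq := by
    refine Set.eq_univ_of_forall fun F => ?_
    obtain ⟨a, ha⟩ := F.nonempty
    exact ⟨_, ⟨⟨(a, ∅), Set.finite_empty, by simp⟩, rfl⟩, ha, by simp⟩
  eq_generateFrom := by
    refine congrArg TopologicalSpace.generateFrom (Set.ext fun U => ?_)
    constructor
    · rintro ⟨x, X, hX, hx, rfl⟩
      exact ⟨⟨(x, X), hX, hx⟩, rfl⟩
    · rintro ⟨⟨⟨x, X⟩, hX, hx⟩, rfl⟩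
      exact ⟨x, X, hX, hx, rfl⟩

theorem isCompact_basicSet (x : S) (X : Set S) : IsCompact (basicSet x X) := by
  rw [isCompact_iff_ultrafilter_le_nhds]
  intro 𝓤 h𝓤
  have hU : basicSet x X ∈ 𝓤 := Filter.le_principal_iff.1 h𝓤
  have hx : {F : UniversalGroupoid S | x ∈ F} ∈ 𝓤 := Filter.mem_of_superset hU fun F h => h.1
  have meet : ∀ a b y : S, a ≤ y → b ≤ y → {F : UniversalGroupoid S | a ∈ F} ∈ 𝓤 →
      {F : UniversalGroupoid S | b ∈ F} ∈ 𝓤 →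
      {F : UniversalGroupoid S | a * (b⁻¹ * b) ∈ F} ∈ 𝓤 := by
    intro a b y hay hby ha hb
    refine Filter.mem_of_superset (Filter.inter_mem ha hb) ?_
    rintro F ⟨h1, h2⟩
    exact mul_dom_mem h1 (dom_mem_sub h2)
  let L : UniversalGroupoid S :=
    { carrier := {s | ∃ c, c ≤ x ∧ c ≤ s ∧ {F : UniversalGroupoid S | c ∈ F} ∈ 𝓤}
      isProperFilter := by
        refine isProperFilter_of ⟨x, x, le_rfl, le_rfl, hx⟩ ?_ ?_ ?_
        · rintro a ⟨c, h1, h2, h3⟩ b ⟨d, h4, h5, h6⟩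
          have hm := meet_below h1 h4
          exact ⟨c * (d⁻¹ * d), ⟨_, hm.1.trans h1, le_rfl, meet c d x h1 h4 h3 h6⟩,
            hm.1.trans h2, hm.2.1.trans h5⟩
        · rintro a b hab ⟨c, h1, h2, h3⟩
          exact ⟨c, h1, h2.trans hab, h3⟩
        · rintro z ⟨c, h1, h2, h3⟩ hz
          obtain ⟨F, hF⟩ := 𝓤.nonempty_of_mem h3
          exact F.not_bot hF (isBot_of_le hz h2) }
  have hL : ∀ s, s ∈ L ↔ ∃ c, c ≤ x ∧ c ≤ s ∧ {F : UniversalGroupoid S | c ∈ F} ∈ 𝓤 :=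
    fun s => Iff.rfl
  refine ⟨L, ⟨⟨x, le_rfl, le_rfl, hx⟩, ?_⟩, ?_⟩
  · intro y hy hyL
    obtain ⟨c, h1, h2, h3⟩ := (hL y).1 hyL
    obtain ⟨F, hF1, hF2⟩ := 𝓤.nonempty_of_mem (Filter.inter_mem h3 hU)
    exact hF2.2 y hy (F.up h2 hF1)
  · rw [isTopologicalBasis_basicSet.nhds_hasBasis.ge_iff]
    rintro _ ⟨⟨⟨⟨y, Y⟩, hY, hy⟩, rfl⟩, hyL, hYL⟩
    obtain ⟨c, h1, h2, h3⟩ := (hL y).1 hyL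
    have h4 : (⋂ w ∈ Y, {F : UniversalGroupoid S | w ∈ F}ᶜ) ∈ 𝓤 := by
      refine (Filter.biInter_mem hY).2 fun w hw => ?_
      refine Ultrafilter.compl_mem_iff_notMem.2 fun hw' => hYL w hw ?_
      have hm := meet_below h2 (hy w hw)
      exact (hL w).2 ⟨_, hm.1.trans h1, hm.2.1, meet c w y h2 (hy w hw) h3 hw'⟩
    refine Filter.mem_of_superset (Filter.inter_mem h3 h4) ?_
    rintro F ⟨hF1, hF2⟩
    exact ⟨F.up h2 hF1, fun w hw => Set.mem_iInter₂.1 hF2 w hw⟩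

theorem isCompact_isOpen_iff (U : Set (UniversalGroupoid S)) :
    IsCompact U ∧ IsOpen U ↔
      ∃ s : Set (BasicIndex S), s.Finite ∧ U = ⋃ i ∈ s, basicSet i.1.1 i.1.2 :=
  isCompact_open_iff_eq_finite_iUnion_of_isTopologicalBasis _ isTopologicalBasis_basicSet
    (fun _ => isCompact_basicSet _ _) U

theorem isOpen_basicSet {x : S} {X : Set S} (hX : X.Finite) (hx : ∀ y ∈ X, y ≤ x) :
    IsOpen (basicSet x X) :=
  isTopologicalBasis_basicSet.isOpen ⟨⟨(x, X), hX, hx⟩, rfl⟩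

/-- Every filter containing `x * y` is a product of filters containing `x` and `y`. -/
theorem exists_mul {H : UniversalGroupoid S} {x y : S} (h : x * y ∈ H) :
    ∃ (F G : UniversalGroupoid S) (hFG : F.dom = G.ran), x ∈ F ∧ y ∈ G ∧ H = F.mul G hFG := by
  let G : UniversalGroupoid S :=
    { carrier := {s | ∃ a ∈ H, y * (a⁻¹ * a) ≤ s}
      isProperFilter := by
        refine isProperFilter_of ⟨_, _, h, le_rfl⟩ ?_ ?_ ?_
        · rintro s ⟨a, ha, hs⟩ t ⟨b, hb, ht⟩
          obtain ⟨c, hc, h1, h2⟩ := H.dir ha hb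
          exact ⟨_, ⟨c, hc, le_rfl⟩,
            (mul_le_mul'' le_rfl (mul_le_mul'' (inv_le_inv' h1) h1)).trans hs,
            (mul_le_mul'' le_rfl (mul_le_mul'' (inv_le_inv' h2) h2)).trans ht⟩
        · rintro s t hst ⟨a, ha, hs⟩
          exact ⟨a, ha, hs.trans hst⟩
        · rintro z ⟨a, ha, hz⟩ hbot
          obtain ⟨c, hc, h1, h2⟩ := H.dir ha h
          have h3 : IsBot (y * (a⁻¹ * a)) := isBot_of_le hbot hz
          have h4 : x * y * (a⁻¹ * a) ∈ H := mul_dom_mem h (dom_mem_sub ha)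
          rw [mul_assoc, (isBot_mul h3 x).2] at h4
          exact H.not_bot h4 h3 }
  have hG : ∀ s, s ∈ G ↔ ∃ a ∈ H, y * (a⁻¹ * a) ≤ s := fun _ => Iff.rfl
  have hyG : y ∈ G := ⟨_, h, mul_idem_le _ (idem_inv_mul _)⟩
  have hdom : H.dom = G.dom := by
    ext s
    rw [mem_dom, mem_dom]
    constructor
    · rintro ⟨a, ha, hs⟩
      refine ⟨_, ⟨a, ha, le_rfl⟩, le_trans ?_ hs⟩
      calc (y * (a⁻¹ * a))⁻¹ * (y * (a⁻¹ * a)) = (a⁻¹ * a) * ((y⁻¹ * y) * (a⁻¹ * a)) := by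
            rw [mul_inv_rev', idem_inv (idem_inv_mul a)]; simp only [mul_assoc]
        _ = (a⁻¹ * a) * (y⁻¹ * y) := by
            rw [idem_comm (idem_inv_mul y) (idem_inv_mul a), ← mul_assoc, (idem_inv_mul a).eq]
        _ ≤ a⁻¹ * a := mul_idem_le _ (idem_inv_mul y)
    · rintro ⟨b, ⟨a, ha, hb⟩, hs⟩
      obtain ⟨c, hc, h1, h2⟩ := H.dir ha h
      refine ⟨c, hc, le_trans ?_ hs⟩
      have h3 : y * (c⁻¹ * c) ≤ b :=
        (mul_le_mul'' le_rfl (mul_le_mul'' (inv_le_inv' h1) h1)).trans hb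
      have h4 : c⁻¹ * c ≤ y⁻¹ * y := by
        refine (mul_le_mul'' (inv_le_inv' h2) h2).trans ?_
        calc (x * y)⁻¹ * (x * y) = y⁻¹ * ((x⁻¹ * x) * y) := by
              rw [mul_inv_rev']; simp only [mul_assoc]
          _ ≤ y⁻¹ * y := mul_le_mul'' le_rfl (idem_mul_le _ (idem_inv_mul x))
      have h5 := idem_le (idem_inv_mul c) h4
      calc c⁻¹ * c = (c⁻¹ * c) * (y⁻¹ * y * (c⁻¹ * c)) := by rw [h5, (idem_inv_mul c).eq]
        _ = (y * (c⁻¹ * c))⁻¹ * (y * (c⁻¹ * c)) := by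
            rw [mul_inv_rev', idem_inv (idem_inv_mul c)]; simp only [mul_assoc]
        _ ≤ b⁻¹ * b := mul_le_mul'' (inv_le_inv' h3) h3
  have h1 : H.dom = G.inv.ran := by rw [ran_inv, hdom]
  have h2 : (H.mul G.inv h1).dom = G.ran := by rw [dom_mul, dom_inv]
  refine ⟨H.mul G.inv h1, G, h2, ?_, hyG, ?_⟩
  · obtain ⟨c, hc, -, h3⟩ := H.dir h h
    refine ⟨c, hc, _, inv_mem_inv ((hG _).2 ⟨c, hc, le_rfl⟩), ?_⟩
    calc c * (y * (c⁻¹ * c))⁻¹ = (c * c⁻¹ * c) * y⁻¹ := by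
          rw [mul_inv_rev', idem_inv (idem_inv_mul c)]; simp only [mul_assoc]
      _ = c * y⁻¹ := by rw [mul_inv_mul]
      _ ≤ x * y * y⁻¹ := mul_le_mul'' h3 le_rfl
      _ ≤ x := by rw [mul_assoc]; exact mul_idem_le _ (idem_mul_inv y)
  · have h3 : G.inv.dom = G.ran := dom_inv G
    have h4 : H.dom = (G.inv.mul G h3).ran := by rw [ran_mul, h1]
    rw [mul_assoc' H G.inv G h1 h2 h3 h4]
    exact (mul_dom_self _ _ _ (by rw [inv_mul_self, hdom])).symm

theorem inv_mul_mul {F G : UniversalGroupoid S} (h : F.dom = G.ran) {x w : S} (hx : x ∈ F)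
    (hw : w ∈ F.mul G h) : x⁻¹ * w ∈ G := by
  have h1 : F.inv.dom = (F.mul G h).ran := by rw [ran_mul, dom_inv]
  have h2 : F.inv.dom = F.ran := dom_inv F
  have h3 : (F.inv.mul F h2).dom = G.ran := by rw [dom_mul, h]
  have h4 := mul_mem_mul h1 (inv_mem_inv hx) hw
  rw [← mul_assoc' F.inv F G h2 h3 h h1] at h4
  rwa [ran_mul_self _ _ h3 (by rw [inv_mul_self, h])] at h4

/-- `U_{x;X} U_{y;Y} = U_{xy; xY ∪ Xy}`. -/
theorem setMul_basicSet (x y : S) (X Y : Set S) :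
    setMul (basicSet x X) (basicSet y Y) =
      basicSet (x * y) ((fun w => x * w) '' Y ∪ (fun w => w * y) '' X) := by
  ext H
  constructor
  · rintro ⟨F, ⟨hx, hXF⟩, G, ⟨hy, hYG⟩, h, rfl⟩
    refine ⟨mul_mem_mul h hx hy, ?_⟩
    rintro _ (⟨w, hw, rfl⟩ | ⟨w, hw, rfl⟩) hmem
    · have h1 := inv_mul_mul h hx hmem
      rw [← mul_assoc] at h1
      exact hYG w hw (G.up (idem_mul_le _ (idem_inv_mul x)) h1)
    · refine hXF w hw ?_
      have h1 : (F.mul G h).dom = G.inv.ran := by rw [dom_mul, ran_inv]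
      have h2 : F.dom = (G.mul G.inv (ran_inv G).symm).ran := by rw [ran_mul, h]
      have h3 := mul_mem_mul h1 hmem (inv_mem_inv hy)
      rw [mul_assoc' F G G.inv h h1 (ran_inv G).symm h2,
        mul_dom_self _ _ _ (by rw [mul_inv_self, h])] at h3
      rw [mul_assoc] at h3
      exact F.up (mul_idem_le _ (idem_mul_inv y)) h3
  · rintro ⟨hH, hn⟩
    obtain ⟨F, G, h, hx, hy, rfl⟩ := exists_mul hH
    refine ⟨F, ⟨hx, fun w hw hwF => ?_⟩, G, ⟨hy, fun w hw hwG => ?_⟩, h, rfl⟩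
    · exact hn _ (Or.inr ⟨w, hw, rfl⟩) (mul_mem_mul h hwF hy)
    · exact hn _ (Or.inl ⟨w, hw, rfl⟩) (mul_mem_mul h hx hwG)

theorem setInv_basicSet (x : S) (X : Set S) :
    setInv (basicSet x X) = basicSet x⁻¹ ((fun w => w⁻¹) '' X) := by
  ext F
  rw [mem_setInv]
  constructor
  · rintro ⟨h1, h2⟩
    refine ⟨h1, ?_⟩
    rintro _ ⟨w, hw, rfl⟩ h
    exact h2 w hw h
  · rintro ⟨h1, h2⟩
    exact ⟨h1, fun w hw h => h2 _ ⟨w, hw, rfl⟩ h⟩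

theorem isCompact_isOpen_setMul {A B : Set (UniversalGroupoid S)} (hA : IsCompact A ∧ IsOpen A)
    (hB : IsCompact B ∧ IsOpen B) : IsCompact (setMul A B) ∧ IsOpen (setMul A B) := by
  obtain ⟨s, hs, rfl⟩ := (isCompact_isOpen_iff A).1 hA
  obtain ⟨t, ht, rfl⟩ := (isCompact_isOpen_iff B).1 hB
  have h : setMul (⋃ i ∈ s, basicSet i.1.1 i.1.2) (⋃ i ∈ t, basicSet i.1.1 i.1.2) =
      ⋃ p ∈ s ×ˢ t, setMul (basicSet p.1.1.1 p.1.1.2) (basicSet p.2.1.1 p.2.1.2) := by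
    ext H
    simp only [Set.mem_iUnion, setMul, Set.mem_ofPred_eq, Set.mem_prod]
    constructor
    · rintro ⟨F, ⟨i, hi, hF⟩, G, ⟨j, hj, hG⟩, h, rfl⟩
      exact ⟨(i, j), ⟨hi, hj⟩, F, hF, G, hG, h, rfl⟩
    · rintro ⟨⟨i, j⟩, ⟨hi, hj⟩, F, hF, G, hG, h, rfl⟩
      exact ⟨F, ⟨i, hi, hF⟩, G, ⟨j, hj, hG⟩, h, rfl⟩
  have key : ∀ i j : BasicIndex S,
      IsCompact (setMul (basicSet i.1.1 i.1.2) (basicSet j.1.1 j.1.2)) ∧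
      IsOpen (setMul (basicSet i.1.1 i.1.2) (basicSet j.1.1 j.1.2)) := by
    rintro ⟨⟨x, X⟩, hX, hx⟩ ⟨⟨y, Y⟩, hY, hy⟩
    dsimp only
    rw [setMul_basicSet]
    refine ⟨isCompact_basicSet _ _, isOpen_basicSet ((hY.image _).union (hX.image _)) ?_⟩
    rintro _ (⟨w, hw, rfl⟩ | ⟨w, hw, rfl⟩)
    · exact mul_le_mul'' le_rfl (hy w hw)
    · exact mul_le_mul'' (hx w hw) le_rfl
  rw [h]
  exact ⟨(hs.prod ht).isCompact_biUnion fun p _ => (key p.1 p.2).1,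
    isOpen_biUnion fun p _ => (key p.1 p.2).2⟩

theorem isCompact_isOpen_setInv {A : Set (UniversalGroupoid S)} (hA : IsCompact A ∧ IsOpen A) :
    IsCompact (setInv A) ∧ IsOpen (setInv A) := by
  obtain ⟨s, hs, rfl⟩ := (isCompact_isOpen_iff A).1 hA
  have h : setInv (⋃ i ∈ s, basicSet i.1.1 i.1.2) = ⋃ i ∈ s, setInv (basicSet i.1.1 i.1.2) := by
    ext H
    simp only [Set.mem_iUnion, mem_setInv]
  rw [h]
  simp only [setInv_basicSet]
  refine ⟨hs.isCompact_biUnion fun p _ => isCompact_basicSet _ _,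
    isOpen_biUnion fun p _ => isOpen_basicSet (p.2.1.image _) ?_⟩
  rintro _ ⟨w, hw, rfl⟩
  exact inv_le_inv' (p.2.2 w hw)

theorem IsBisection.setMul {A B : Set (UniversalGroupoid S)} (hA : IsBisection A)
    (hB : IsBisection B) : IsBisection (setMul A B) := by
  rw [isBisection_iff] at *
  constructor
  · rintro _ ⟨F, hF, G, hG, h, rfl⟩ _ ⟨F', hF', G', hG', h', rfl⟩ heq
    rw [dom_mul, dom_mul] at heq
    obtain rfl := hB.1 G hG G' hG' heq
    obtain rfl := hA.1 F hF F' hF' (h.trans h'.symm)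
    rfl
  · rintro _ ⟨F, hF, G, hG, h, rfl⟩ _ ⟨F', hF', G', hG', h', rfl⟩ heq
    rw [ran_mul, ran_mul] at heq
    obtain rfl := hA.2 F hF F' hF' heq
    obtain rfl := hB.2 G hG G' hG' (h.symm.trans h')
    rfl

theorem IsBisection.setInv {A : Set (UniversalGroupoid S)} (hA : IsBisection A) :
    IsBisection (setInv A) := by
  refine ⟨?_, hA.1.trans' ?_⟩
  · rw [setInv_setInv]; exact hA.2
  · rw [setInv_setInv]

theorem setMul_assoc (A B C : Set (UniversalGroupoid S)) :
    setMul (setMul A B) C = setMul A (setMul B C) := by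
  ext H
  constructor
  · rintro ⟨_, ⟨F, hF, G, hG, h, rfl⟩, K, hK, h', rfl⟩
    have h1 : G.dom = K.ran := by rw [← h', dom_mul]
    have h2 : F.dom = (G.mul K h1).ran := by rw [ran_mul, h]
    exact ⟨F, hF, _, ⟨G, hG, K, hK, h1, rfl⟩, h2, mul_assoc' _ _ _ _ _ _ _⟩
  · rintro ⟨F, hF, _, ⟨G, hG, K, hK, h, rfl⟩, h', rfl⟩
    have h1 : F.dom = G.ran := by rw [h', ran_mul]
    have h2 : (F.mul G h1).dom = K.ran := by rw [dom_mul, h]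
    exact ⟨_, ⟨F, hF, G, hG, h1, rfl⟩, K, hK, h2, (mul_assoc' _ _ _ _ _ _ _).symm⟩

theorem setMul_setInv_setMul {A : Set (UniversalGroupoid S)} (hA : IsBisection A) :
    setMul (setMul A (setInv A)) A = A := by
  rw [isBisection_iff] at hA
  ext H
  constructor
  · rintro ⟨_, ⟨F, hF, _, ⟨G, hG, rfl⟩, h, rfl⟩, K, hK, h', rfl⟩
    obtain rfl := hA.1 F hF G hG (by rw [h, ran_inv])
    rwa [ran_mul_self _ _ h' (by rw [mul_inv_self, ← h', dom_mul, dom_inv])]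
  · intro hH
    have h1 : H.dom = H.inv.ran := (ran_inv H).symm
    have h2 : (H.mul H.inv h1).dom = H.ran := by rw [dom_mul, dom_inv]
    exact ⟨_, ⟨H, hH, _, ⟨H, hH, rfl⟩, h1, rfl⟩, H, hH, h2,
      (ran_mul_self _ _ h2 (mul_inv_self _ _)).symm⟩

theorem subset_setInv {A B : Set (UniversalGroupoid S)} (hB : IsBisection B)
    (h2 : setMul (setMul B A) B = B) : B ⊆ setInv A := by
  rw [isBisection_iff] at hB
  intro b hb
  rw [← h2] at hb
  obtain ⟨_, ⟨F, hF, G, hG, h, rfl⟩, K, hK, h', rfl⟩ := hb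
  have hmem : (F.mul G h).mul K h' ∈ B := by
    rw [← h2]; exact ⟨_, ⟨F, hF, G, hG, h, rfl⟩, K, hK, h', rfl⟩
  have hK' := hB.1 _ hmem K hK (dom_mul _ _ _)
  have hF' := hB.2 _ hmem F hF (by rw [ran_mul, ran_mul])
  have hKF : F = K := hF'.symm.trans hK'
  subst hKF
  rw [hF', mem_setInv]
  have h3 : (F.mul G h) = F.ran := by
    have h4 : F.dom = F.inv.ran := (ran_inv F).symm
    have h5 : ((F.mul G h).mul F h').dom = F.inv.ran := by rw [dom_mul, h4]
    have h6 : (F.mul G h).dom = (F.mul F.inv h4).ran := by rw [h', ran_mul]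
    have h7 := mul_assoc' (F.mul G h) F F.inv h' h5 h4 h6
    rw [mul_dom_self _ _ h6 (by rw [mul_inv_self, h'])] at h7
    rw [← h7]
    simp only [hF', mul_inv_self]
  have h4 : F.inv.dom = (F.mul G h).ran := by rw [dom_inv, ran_mul]
  have h5 : (F.inv.mul F (dom_inv F)).dom = G.ran := by rw [dom_mul, h]
  have h6 := mul_assoc' F.inv F G (dom_inv F) h5 h h4
  rw [ran_mul_self _ _ h5 (by rw [inv_mul_self, h]), mul_dom_self _ _ h4 (by rw [h3, dom_inv])]
    at h6
  rwa [← h6]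

end UniversalGroupoid

open UniversalGroupoid in
/-- The booleanization `B(S)` of an inverse semigroup `S`: the set of compact-open bisections of
its universal groupoid. -/
structure Booleanization (S : Type*) [InverseSemigroup S] where
  carrier : Set (UniversalGroupoid S)
  isCompact : IsCompact carrier
  isOpen : IsOpen carrier
  isBisection : IsBisection carrier

namespace Booleanization

open UniversalGroupoid

variable {S : Type*} [InverseSemigroup S]

@[ext] theorem ext {A B : Booleanization S} (h : A.carrier = B.carrier) : A = B := by
  cases A; cases B; congr

/-- `B(S)` is an inverse semigroup under subset multiplication and subset inversion. -/
instance : InverseSemigroup (Booleanization S) where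
  mul A B :=
    { carrier := setMul A.carrier B.carrier
      isCompact := (isCompact_isOpen_setMul ⟨A.isCompact, A.isOpen⟩ ⟨B.isCompact, B.isOpen⟩).1
      isOpen := (isCompact_isOpen_setMul ⟨A.isCompact, A.isOpen⟩ ⟨B.isCompact, B.isOpen⟩).2
      isBisection := A.isBisection.setMul B.isBisection }
  mul_assoc A B C := ext (setMul_assoc _ _ _)
  inv A :=
    { carrier := setInv A.carrier
      isCompact := (isCompact_isOpen_setInv ⟨A.isCompact, A.isOpen⟩).1
      isOpen := (isCompact_isOpen_setInv ⟨A.isCompact, A.isOpen⟩).2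
      isBisection := A.isBisection.setInv }
  mul_inv_mul A := ext (setMul_setInv_setMul A.isBisection)
  inv_mul_inv A := ext (by
    have h := setMul_setInv_setMul A.isBisection.setInv
    rwa [setInv_setInv] at h)
  eq_inv_of A B h1 h2 := ext (by
    have h1' := congrArg carrier h1
    have h2' := congrArg carrier h2
    refine Set.Subset.antisymm (subset_setInv B.isBisection h2') ?_
    intro F hF
    have h3 := subset_setInv A.isBisection h1' (mem_setInv.1 hF)
    rwa [mem_setInv, inv_inv_eq] at h3)

theorem carrier_mul (A B : Booleanization S) :
    (A * B).carrier = setMul A.carrier B.carrier := rfl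

theorem carrier_inv (A : Booleanization S) : A⁻¹.carrier = setInv A.carrier := rfl

theorem idem_iff {A : Booleanization S} :
    IsIdempotentElem A ↔ A.carrier ⊆ identities S := by
  constructor
  · intro h
    have h1 := h.eq
    nth_rewrite 1 [← InverseSemigroup.idem_inv h] at h1
    rw [← h1]
    exact A.isBisection.1
  · intro h
    have hA := isBisection_iff.1 A.isBisection
    refine ext (Set.Subset.antisymm ?_ ?_)
    · rintro _ ⟨F, hF, G, hG, hFG, rfl⟩
      rwa [ran_mul_self _ _ hFG (by rw [← hFG]; exact (identity_eq (h hF)).1)]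
    · intro F hF
      have hF' := identity_eq (h hF)
      have h1 : F.dom = F.ran := hF'.1.symm.trans hF'.2
      exact ⟨F, hF, F, hF, h1, (mul_dom_self _ _ _ hF'.1).symm⟩

/-- The natural partial order of `B(S)` is inclusion. -/
theorem le_iff {A B : Booleanization S} : A ≤ B ↔ A.carrier ⊆ B.carrier := by
  constructor
  · rintro ⟨E, hE, rfl⟩
    rintro _ ⟨F, hF, G, hG, h, rfl⟩
    rwa [mul_dom_self _ _ h (by rw [h]; exact (identity_eq (idem_iff.1 hE hG)).2)]
  · intro h
    refine ⟨A⁻¹ * A, InverseSemigroup.idem_inv_mul A, ext (Set.Subset.antisymm ?_ ?_)⟩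
    · intro F hF
      have h1 : F.inv.dom = F.ran := dom_inv F
      have h2 : F.dom = (F.inv.mul F h1).ran := by rw [ran_mul, ran_inv]
      exact ⟨F, h hF, _, ⟨_, ⟨F, hF, rfl⟩, F, hF, h1, rfl⟩, h2,
        (mul_dom_self _ _ _ (inv_mul_self _ _)).symm⟩
    · rintro _ ⟨F, hF, _, ⟨_, ⟨G, hG, rfl⟩, K, hK, h1, rfl⟩, h2, rfl⟩
      have hA := isBisection_iff.1 A.isBisection
      have hB := isBisection_iff.1 B.isBisection
      obtain rfl := hA.2 G hG K hK (by rw [← h1, dom_inv])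
      have h3 : F.dom = G.dom := by rw [h2, ran_mul, ran_inv]
      obtain rfl := hB.1 F hF G (h hG) h3
      rwa [mul_dom_self _ _ _ (inv_mul_self _ _)]

open InverseSemigroup

/-- The union of a finite compatible family of compact-open bisections. -/
def sUnion (𝒜 : Set (Booleanization S)) (hfin : 𝒜.Finite)
    (hcomp : ∀ A ∈ 𝒜, ∀ B ∈ 𝒜, Compatible A B) : Booleanization S where
  carrier := ⋃ A ∈ 𝒜, A.carrier
  isCompact := hfin.isCompact_biUnion fun A _ => A.isCompact
  isOpen := isOpen_biUnion fun A _ => A.isOpen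
  isBisection := by
    constructor
    · rintro _ ⟨_, ⟨F, hF, rfl⟩, G, hG, h, rfl⟩
      simp only [Set.mem_iUnion] at hF hG
      obtain ⟨A, hA, hF⟩ := hF
      obtain ⟨B, hB, hG⟩ := hG
      exact idem_iff.1 (hcomp A hA B hB).1 ⟨_, ⟨F, hF, rfl⟩, G, hG, h, rfl⟩
    · rintro _ ⟨F, hF, _, ⟨G, hG, rfl⟩, h, rfl⟩
      simp only [Set.mem_iUnion] at hF hG
      obtain ⟨A, hA, hF⟩ := hF
      obtain ⟨B, hB, hG⟩ := hG
      exact idem_iff.1 (hcomp A hA B hB).2 ⟨F, hF, _, ⟨G, hG, rfl⟩, h, rfl⟩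

theorem isLUB_of_carrier {𝒜 : Set (Booleanization S)} {B : Booleanization S}
    (h : B.carrier = ⋃ A ∈ 𝒜, A.carrier) : IsLUB 𝒜 B := by
  constructor
  · intro A hA
    rw [le_iff, h]
    exact Set.subset_biUnion_of_mem hA
  · intro C hC
    rw [le_iff, h]
    exact Set.iUnion₂_subset fun A hA => le_iff.1 (hC hA)

theorem carrier_of_isLUB {𝒜 : Set (Booleanization S)} {B : Booleanization S} (hfin : 𝒜.Finite)
    (h : IsLUB 𝒜 B) : B.carrier = ⋃ A ∈ 𝒜, A.carrier := by
  have hcomp : ∀ A ∈ 𝒜, ∀ C ∈ 𝒜, Compatible A C := fun A hA C hC =>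
    Compatible.of_le (h.1 hA) (h.1 hC)
  rw [h.unique (isLUB_of_carrier (B := sUnion 𝒜 hfin hcomp) rfl)]
  rfl

instance : IsDistributive (Booleanization S) where
  exists_isLUB 𝒜 hfin hcomp := ⟨sUnion 𝒜 hfin hcomp, isLUB_of_carrier rfl⟩
  mul_isLUB 𝒜 B C hfin h := by
    refine isLUB_of_carrier ?_
    rw [carrier_mul, carrier_of_isLUB hfin h, Set.biUnion_image]
    ext H
    simp only [carrier_mul, setMul, Set.mem_iUnion, Set.mem_ofPred_eq]
    constructor
    · rintro ⟨F, hF, G, ⟨A, hA, hG⟩, e, rfl⟩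
      exact ⟨A, hA, F, hF, G, hG, e, rfl⟩
    · rintro ⟨A, hA, F, hF, G, hG, e, rfl⟩
      exact ⟨F, hF, G, ⟨A, hA, hG⟩, e, rfl⟩
  isLUB_mul 𝒜 B C hfin h := by
    refine isLUB_of_carrier ?_
    rw [carrier_mul, carrier_of_isLUB hfin h, Set.biUnion_image]
    ext H
    simp only [carrier_mul, setMul, Set.mem_iUnion, Set.mem_ofPred_eq]
    constructor
    · rintro ⟨F, ⟨A, hA, hF⟩, G, hG, e, rfl⟩
      exact ⟨A, hA, F, hF, G, hG, e, rfl⟩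
    · rintro ⟨A, hA, F, hF, G, hG, e, rfl⟩
      exact ⟨F, ⟨A, hA, hF⟩, G, hG, e, rfl⟩

/-- The homomorphism `β : S → B(S)`, `β(s) = U_s`, where `U_s` is the set of all proper filters
that contain `s`. -/
def β (S : Type*) [InverseSemigroup S] : S →ₙ* Booleanization S where
  toFun s :=
    { carrier := {F | s ∈ F}
      isCompact := by
        have h := isCompact_basicSet s ∅
        simpa [basicSet] using h
      isOpen := by
        have h := isOpen_basicSet (x := s) Set.finite_empty (by simp)
        simpa [basicSet] using h
      isBisection := isBisection_iff.2
        ⟨fun _ hF _ hG h => eq_of_dom_eq h hF hG, fun _ hF _ hG h => eq_of_ran_eq h hF hG⟩ }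
  map_mul' s t := by
    ext H
    constructor
    · intro hH
      obtain ⟨F, G, h, hs, ht, rfl⟩ := exists_mul hH
      exact ⟨F, hs, G, ht, h, rfl⟩
    · rintro ⟨F, hF, G, hG, h, rfl⟩
      exact mul_mem_mul h hF hG

end Booleanization

/-! An element of `T` is determined by the set of prime filters containing it, and the hypothesis on
`θ` says exactly that prime filters of `T` pull back to points of `𝖦_u(S)`. So a compact-open
bisection `A` should go to the element `t` of `T` whose prime filters are those with pullback in
`A`. This condition is `Represents`, and both existence and uniqueness of the extension reduce to
it.

Separation of elements by prime filters (`le_of_forall_isPrime`) makes a representing element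
unique. Since factors of prime filters are prime, and pullback respects domains, ranges and
products, representation turns subset products into products of `T` (`Represents.mul`) and unions
into joins (`Represents.isLUB`).

For existence of `t`, a basic set `U_{x;X}` is represented by the complement in `θ x` of the join of
`θ(X)`; here weak booleanness is used. A compact-open bisection is a finite union of basic sets,
whose representing elements are compatible because the union is a bisection, so their join exists
(`exists_represents`).

For uniqueness, any morphism extending `θ` must send `A` to an element representing `A`: on
`U_{x;X}` this is forced by `U_x` being the join of `U_{x;X}` and the `U_y`, and general `A` are
finite joins of these (`represents_of_comp_β`). -/

namespace InverseSemigroup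

/-! ### Preliminaries on homomorphisms and joins -/

variable {S T : Type*} [InverseSemigroup S] [InverseSemigroup T]

theorem map_inv' (θ : S →ₙ* T) (a : S) : θ a⁻¹ = (θ a)⁻¹ :=
  eq_inv_of _ _ (by rw [← map_mul, ← map_mul, mul_inv_mul])
    (by rw [← map_mul, ← map_mul, inv_mul_inv])

theorem map_le (θ : S →ₙ* T) {a b : S} (h : a ≤ b) : θ a ≤ θ b := by
  obtain ⟨e, he, rfl⟩ := h
  exact ⟨θ e, he.map θ, map_mul θ b e⟩

theorem isIdempotentElem_of_le_inv_mul {a : S} (h : a ≤ a⁻¹ * a) : IsIdempotentElem a :=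
  idem_of_le (idem_inv_mul a) h

end InverseSemigroup

theorem DistributiveHom.ext_apply {S T : Type*} [InverseSemigroup S] [InverseSemigroup T]
    [IsDistributive S] [IsDistributive T] {φ ψ : DistributiveHom S T}
    (h : ∀ s, φ.toMulHom s = ψ.toMulHom s) : φ = ψ := by
  obtain ⟨φ, hφ⟩ := φ
  obtain ⟨ψ, hψ⟩ := ψ
  obtain rfl : φ = ψ := MulHom.ext h
  rfl

/-- Splits one element off a join, so that primeness, stated for binary joins, extends to finite
joins by induction. -/
theorem IsLUB.pair_of_insert {α : Type*} [PartialOrder α] {a c d : α} {A : Set α}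
    (hc : IsLUB (insert a A) c) (hd : IsLUB A d) : IsLUB {a, d} c := by
  refine ⟨?_, fun u hu => hc.2 ?_⟩
  · rintro _ (rfl | rfl)
    · exact hc.1 (Or.inl rfl)
    · exact hd.2 fun b hb => hc.1 (Or.inr hb)
  · rintro b (rfl | hb)
    · exact hu (Or.inl rfl)
    · exact (hd.1 hb).trans (hu (Or.inr rfl))

namespace UniversalGroupoid

open InverseSemigroup

/-! ### Prime filters of a distributive inverse semigroup -/

section Prime

variable {T : Type*} [InverseSemigroup T]

/-- A point of the universal groupoid is prime if the underlying filter is. -/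
def IsPrime (P : UniversalGroupoid T) : Prop := IsPrimeFilter P.carrier

theorem IsPrime.mem_or_mem {P : UniversalGroupoid T} (hP : P.IsPrime) {a b c : T}
    (h : IsLUB {a, b} c) (hc : c ∈ P) : a ∈ P ∨ b ∈ P :=
  hP.prime a b c h hc

theorem isPrime_of {P : UniversalGroupoid T}
    (h : ∀ a b c : T, IsLUB {a, b} c → c ∈ P → a ∈ P ∨ b ∈ P) : P.IsPrime :=
  { P.isProperFilter with prime := h }

variable [IsDistributive T]

theorem exists_isLUB_of_bounded {A : Set T} (hA : A.Finite) {x : T} (hx : ∀ a ∈ A, a ≤ x) :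
    ∃ s, IsLUB A s :=
  IsDistributive.exists_isLUB A hA fun a ha b hb => Compatible.of_le (hx a ha) (hx b hb)

/-- Induction on the family. The empty join is a zero, which a proper filter excludes; the
intermediate joins exist because all members lie below `c`. -/
theorem IsPrime.exists_mem_of_isLUB {P : UniversalGroupoid T} (hP : P.IsPrime) {A : Set T}
    (hA : A.Finite) : ∀ {c : T}, IsLUB A c → c ∈ P → ∃ a ∈ A, a ∈ P := by
  induction A, hA using Set.Finite.induction_on with
  | empty =>
    intro c hc hcP
    exact absurd (isLUB_empty_iff.1 hc) (P.not_bot hcP)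
  | insert _ hA ih =>
    intro c hc hcP
    obtain ⟨d, hd⟩ := exists_isLUB_of_bounded hA fun b hb => hc.1 (Or.inr hb)
    rcases hP.mem_or_mem (hc.pair_of_insert hd) hcP with h | h
    · exact ⟨_, Or.inl rfl, h⟩
    · obtain ⟨b, hb, hbP⟩ := ih hd h
      exact ⟨b, Or.inr hb, hbP⟩

/-- Left multiplication by a fixed `x ∈ F` preserves the join and carries `G` into `F · G`.
Conversely `x * d ∈ F · G` gives `x⁻¹ * x * d ∈ G`, which is below `d`. -/
theorem IsPrime.of_mul_right {F G : UniversalGroupoid T} {h : F.dom = G.ran}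
    (hP : (F.mul G h).IsPrime) : G.IsPrime := by
  refine isPrime_of fun a b c hc hcG => ?_
  obtain ⟨x, hx⟩ := F.nonempty
  have h1 := IsDistributive.mul_isLUB {a, b} c x (by simp) hc
  rw [Set.image_pair] at h1
  have key : ∀ d, x * d ∈ F.mul G h → d ∈ G := fun d hd => by
    have h2 := inv_mul_mul h hx hd
    rw [← mul_assoc] at h2
    exact G.up (idem_mul_le _ (idem_inv_mul x)) h2
  exact (hP.mem_or_mem h1 (mul_mem_mul h hx hcG)).imp (key a) (key b)

theorem IsPrime.of_mul_left {F G : UniversalGroupoid T} {h : F.dom = G.ran}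
    (hP : (F.mul G h).IsPrime) : F.IsPrime := by
  refine isPrime_of fun a b c hc hcF => ?_
  obtain ⟨y, hy⟩ := G.nonempty
  have h1 := IsDistributive.isLUB_mul {a, b} c y (by simp) hc
  rw [Set.image_pair] at h1
  have key : ∀ d, d * y ∈ F.mul G h → d ∈ F := fun d hd => by
    have h1 : (F.mul G h).dom = G.inv.ran := by rw [dom_mul, ran_inv]
    have h2 : F.dom = (G.mul G.inv (ran_inv G).symm).ran := by rw [ran_mul, h]
    have h3 := mul_mem_mul h1 hd (inv_mem_inv hy)
    rw [mul_assoc' F G G.inv h h1 (ran_inv G).symm h2,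
      mul_dom_self _ _ _ (by rw [mul_inv_self, h]), mul_assoc] at h3
    exact F.up (mul_idem_le _ (idem_mul_inv y)) h3
  exact (hP.mem_or_mem h1 (mul_mem_mul h hcF hy)).imp (key a) (key b)

/-- Since `P = P · (P⁻¹ · P)`, the inverse is a factor of a factor of a prime filter. -/
theorem IsPrime.inv {P : UniversalGroupoid T} (hP : P.IsPrime) : P.inv.IsPrime := by
  have h : P.dom = P.inv.ran := (ran_inv P).symm
  have h1 : P.inv.dom = (P.mul P.inv h).ran := by rw [ran_mul, dom_inv]
  have h2 : P.inv.dom = P.ran := dom_inv P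
  have h3 : P.dom = (P.inv.mul P h2).ran := by rw [ran_mul, ran_inv]
  have h4 : P.mul (P.inv.mul P h2) h3 = P := mul_dom_self _ _ _ (inv_mul_self _ _)
  have h5 : (P.mul (P.inv.mul P h2) h3).IsPrime := by rwa [h4]
  exact h5.of_mul_right.of_mul_left

/-- A maximal filter among those that contain `s` and omit `t` is prime. -/
theorem exists_isPrime_of_not_le {s t : T} (hst : ¬ s ≤ t) :
    ∃ P : UniversalGroupoid T, P.IsPrime ∧ s ∈ P ∧ t ∉ P := by
  -- A zero lies below `t`, so an upper set omitting `t` contains no zero; properness is therefore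
  -- free in the Zorn argument.
  have proper : ∀ F : Set T, t ∉ F → IsUpperSet F → ∀ z ∈ F, ¬ IsBot z :=
    fun F ht hF z hzF hb => ht (hF (hb t) hzF)
  obtain ⟨M, hsM, ⟨⟨hM, htM⟩, hmax⟩⟩ := zorn_subset_nonempty
    {F : Set T | IsProperFilter F ∧ t ∉ F} (by
      rintro C hC hchain ⟨F₀, hF₀⟩
      have ht : t ∉ ⋃₀ C := by
        rintro ⟨F, hF, htF⟩
        exact (hC hF).2 htF
      have hup : IsUpperSet (⋃₀ C) := isUpperSet_sUnion fun F hF => (hC hF).1.isUpperSet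
      refine ⟨⋃₀ C, ⟨⟨?_, ?_, hup, proper _ ht hup⟩, ht⟩, fun F hF => Set.subset_sUnion_of_mem hF⟩
      · obtain ⟨a, ha⟩ := (hC hF₀).1.nonempty
        exact ⟨a, F₀, hF₀, ha⟩
      · exact Set.directedOn_sUnion hchain.directedOn fun F hF => (hC hF).1.directedOn)
    (Set.Ici s) (by
      refine ⟨⟨Set.nonempty_Ici, ?_, isUpperSet_Ici s, proper _ hst (isUpperSet_Ici s)⟩, hst⟩
      exact fun a ha b hb => ⟨s, Set.mem_Ici.2 le_rfl, ha, hb⟩)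
  have hsM : s ∈ M := hsM (Set.mem_Ici.2 le_rfl)
  let P : UniversalGroupoid T := ⟨M, hM⟩
  refine ⟨P, isPrime_of fun a b c hc hcP => ?_, hsM, htM⟩
  -- Below `c`, the product `a * (f⁻¹ * f)` is the meet of `a` and `f`. The filter `G` generated by
  -- these meets contains both `M` and `a`; if it omitted `t`, maximality would put `a` in `M`.
  have key : ∀ a ≤ c, a ∉ P → ∃ f ∈ P, f ≤ c ∧ a * (f⁻¹ * f) ≤ t := by
    intro a hac haP
    by_contra! hcon
    let G : Set T := {x | ∃ f ∈ P, f ≤ c ∧ a * (f⁻¹ * f) ≤ x}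
    have hG : IsUpperSet G := fun x y hxy ⟨f, hf, hfc, hx⟩ => ⟨f, hf, hfc, hx.trans hxy⟩
    have ht : t ∉ G := fun ⟨f, hf, hfc, hx⟩ => hcon f hf hfc hx
    have hmem : G ∈ {F : Set T | IsProperFilter F ∧ t ∉ F} := by
      refine ⟨⟨⟨_, c, hcP, le_rfl, le_rfl⟩, ?_, hG, proper _ ht hG⟩, ht⟩
      rintro x ⟨f, hf, hfc, hx⟩ y ⟨g, hg, -, hy⟩
      obtain ⟨k, hk, h1, h2⟩ := P.dir hf hg
      exact ⟨_, ⟨k, hk, h1.trans hfc, le_rfl⟩,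
        (mul_le_mul'' le_rfl (mul_le_mul'' (inv_le_inv' h1) h1)).trans hx,
        (mul_le_mul'' le_rfl (mul_le_mul'' (inv_le_inv' h2) h2)).trans hy⟩
    have hMG : M ⊆ G := by
      intro x hx
      obtain ⟨k, hk, h1, h2⟩ := P.dir hx hcP
      exact ⟨k, hk, h2, (meet_below hac h2).2.1.trans h1⟩
    exact haP (hmax hmem hMG ⟨c, hcP, le_rfl, mul_idem_le _ (idem_inv_mul c)⟩)
  by_contra! hab
  obtain ⟨f, hf, hfc, hft⟩ := key a (hc.1 (Or.inl rfl)) hab.1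
  obtain ⟨g, hg, hgc, hgt⟩ := key b (hc.1 (Or.inr rfl)) hab.2
  obtain ⟨k, hk, h1, h2⟩ := P.dir hf hg
  -- Restricting `c = a ∨ b` to `k⁻¹ * k` exhibits `k` as a join of two elements below `t`, which
  -- forces `t` into the filter.
  have h3 := IsDistributive.isLUB_mul {a, b} c (k⁻¹ * k) (by simp) hc
  rw [Set.image_pair, ← le_iff_right.1 (h1.trans hfc)] at h3
  refine htM (P.up (h3.2 ?_) hk)
  rintro _ (rfl | rfl)
  · exact (mul_le_mul'' le_rfl (mul_le_mul'' (inv_le_inv' h1) h1)).trans hft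
  · exact (mul_le_mul'' le_rfl (mul_le_mul'' (inv_le_inv' h2) h2)).trans hgt

theorem le_of_forall_isPrime {s t : T}
    (h : ∀ P : UniversalGroupoid T, P.IsPrime → s ∈ P → t ∈ P) : s ≤ t := by
  by_contra hst
  obtain ⟨P, hP, hs, ht⟩ := exists_isPrime_of_not_le hst
  exact ht (h P hP hs)

/-- In a weakly boolean inverse semigroup, every `y ≤ x` has a relative complement in `x`. -/
theorem exists_relative_compl {T : Type*} [InverseSemigroup T] [IsWeaklyBoolean T] {x y : T}
    (hyx : y ≤ x) : ∃ z, ∀ P : UniversalGroupoid T, P.IsPrime → (z ∈ P ↔ x ∈ P ∧ y ∉ P) := by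
  obtain ⟨g, hg, hlub, hbot⟩ := IsWeaklyBoolean.exists_compl (x⁻¹ * x) (y⁻¹ * y)
    (idem_inv_mul x) (idem_inv_mul y) (mul_le_mul'' (inv_le_inv' hyx) hyx)
  -- Multiplying `x⁻¹ * x = y⁻¹ * y ∨ g` by `x` gives `x = y ∨ x * g`.
  have h1 := IsDistributive.mul_isLUB _ _ x (by simp) hlub
  rw [Set.image_pair, ← mul_assoc x x⁻¹ x, mul_inv_mul, ← le_iff_right.1 hyx] at h1
  refine ⟨x * g, fun P hP => ⟨fun hz => ⟨P.up (mul_idem_le x hg) hz, fun hy => ?_⟩, ?_⟩⟩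
  -- If `y` and `x * g` were both in `P`, then so would be `x * g * (y⁻¹ * y)`, which is a zero.
  · have h2 := mul_dom_mem hz (dom_mem_sub hy)
    rw [mul_assoc, idem_comm hg (idem_inv_mul y)] at h2
    exact P.not_bot h2 ((isBot_mul hbot x).2.symm ▸ hbot)
  · rintro ⟨hx, hy⟩
    exact (hP.mem_or_mem h1 hx).resolve_left hy

end Prime

/-! ### Pullback of prime filters along `θ` -/

section Pullback

variable {S T : Type*} [InverseSemigroup S] [InverseSemigroup T] {θ : S →ₙ* T}
  (hθ : ∀ P : Set T, IsPrimeFilter P → IsProperFilter (θ ⁻¹' P))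

/-- The preimage of a prime filter, as a point of the universal groupoid. -/
def comap {P : UniversalGroupoid T} (hP : P.IsPrime) : UniversalGroupoid S :=
  ⟨θ ⁻¹' P.carrier, hθ _ hP⟩

variable {hθ}

theorem mem_comap {P : UniversalGroupoid T} {hP : P.IsPrime} {s : S} :
    s ∈ comap hθ hP ↔ θ s ∈ P := Iff.rfl

/-- The range of a pullback depends only on the range of `P`. The converse direction needs some `a`
with `θ a ∈ P`: then `s * a` is also in the pullback, and `s * a * a⁻¹ ≤ s`. -/
theorem mem_ran_comap {P : UniversalGroupoid T} {hP : P.IsPrime} {s : S} :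
    s ∈ (comap hθ hP).ran ↔ θ s ∈ P.ran := by
  constructor
  · intro h
    obtain ⟨a, ha, hs⟩ := mem_ran.1 h
    refine mem_ran.2 ⟨θ a, ha, ?_⟩
    rw [← map_inv', ← map_mul]
    exact map_le θ hs
  · intro h
    obtain ⟨a, ha⟩ := (comap hθ hP).nonempty
    have h1 : s * a ∈ comap hθ hP := by
      rw [mem_comap, map_mul]
      exact ran_mul_mem ha h
    exact ⟨_, h1, a, ha, by rw [mul_assoc]; exact mul_idem_le s (idem_mul_inv a)⟩

theorem mem_dom_comap {P : UniversalGroupoid T} {hP : P.IsPrime} {s : S} :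
    s ∈ (comap hθ hP).dom ↔ θ s ∈ P.dom := by
  constructor
  · intro h
    obtain ⟨a, ha, hs⟩ := mem_dom.1 h
    refine mem_dom.2 ⟨θ a, ha, ?_⟩
    rw [← map_inv', ← map_mul]
    exact map_le θ hs
  · intro h
    obtain ⟨a, ha⟩ := (comap hθ hP).nonempty
    have h1 : a * s ∈ comap hθ hP := by
      rw [mem_comap, map_mul]
      exact mul_dom_mem ha h
    exact ⟨a, ha, _, h1, by rw [← mul_assoc]; exact idem_mul_le s (idem_inv_mul a)⟩

theorem ran_comap_eq {P Q : UniversalGroupoid T} {hP : P.IsPrime} {hQ : Q.IsPrime}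
    (h : P.ran = Q.ran) : (comap hθ hP).ran = (comap hθ hQ).ran := by
  ext s
  rw [mem_ran_comap, mem_ran_comap, h]

theorem dom_comap_eq {P Q : UniversalGroupoid T} {hP : P.IsPrime} {hQ : Q.IsPrime}
    (h : P.dom = Q.dom) : (comap hθ hP).dom = (comap hθ hQ).dom := by
  ext s
  rw [mem_dom_comap, mem_dom_comap, h]

theorem dom_comap_eq_ran_comap {P Q : UniversalGroupoid T} {hP : P.IsPrime} {hQ : Q.IsPrime}
    (h : P.dom = Q.ran) : (comap hθ hP).dom = (comap hθ hQ).ran := by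
  ext s
  rw [mem_dom_comap, mem_ran_comap, h]

/-- Both sides have the same domain and share an element `a * b`, and a filter is determined by its
domain and any one of its elements. -/
theorem comap_mul {P Q : UniversalGroupoid T} {h : P.dom = Q.ran} {hPQ : (P.mul Q h).IsPrime}
    {hP : P.IsPrime} {hQ : Q.IsPrime} : comap hθ hPQ =
      (comap hθ hP).mul (comap hθ hQ) (dom_comap_eq_ran_comap h) := by
  obtain ⟨a, ha⟩ := (comap hθ hP).nonempty
  obtain ⟨b, hb⟩ := (comap hθ hQ).nonempty
  refine eq_of_dom_eq (a := a * b) ?_ ?_ (mul_mem_mul _ ha hb)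
  · rw [dom_mul]
    exact dom_comap_eq (dom_mul _ _ _)
  · rw [mem_comap, map_mul]
    exact mul_mem_mul _ ha hb

/-! ### Elements of `T` representing sets of filters of `S` -/

variable (hθ)

/-- The element `t` represents the set `A` of filters of `S`: a prime filter contains `t` exactly
when its preimage lies in `A`. -/
def Represents (t : T) (A : Set (UniversalGroupoid S)) : Prop :=
  ∀ (P : UniversalGroupoid T) (hP : P.IsPrime), t ∈ P ↔ comap hθ hP ∈ A

variable {hθ}

theorem Represents.le [IsDistributive T] {t u : T} {A B : Set (UniversalGroupoid S)}
    (ht : Represents hθ t A) (hu : Represents hθ u B) (h : A ⊆ B) : t ≤ u :=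
  le_of_forall_isPrime fun P hP htP => (hu P hP).2 (h ((ht P hP).1 htP))

theorem Represents.unique [IsDistributive T] {t u : T} {A : Set (UniversalGroupoid S)}
    (ht : Represents hθ t A) (hu : Represents hθ u A) : t = u :=
  le_antisymm (ht.le hu subset_rfl) (hu.le ht subset_rfl)

/-- Factorizations lift along pullback: if the pullback of `P` is `F · G`, then `P` itself factors
as `Q · R` with `Q`, `R` pulling back to `F`, `G`. -/
theorem Represents.mul [IsDistributive T] {t u : T} {A B : Set (UniversalGroupoid S)}
    (ht : Represents hθ t A) (hu : Represents hθ u B) : Represents hθ (t * u) (setMul A B) := by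
  intro P hP
  constructor
  · intro h
    obtain ⟨Q, R, hQR, htQ, huR, rfl⟩ := exists_mul h
    exact ⟨_, (ht Q hP.of_mul_left).1 htQ, _, (hu R hP.of_mul_right).1 huR,
      dom_comap_eq_ran_comap hQR, comap_mul⟩
  · rintro ⟨F, hF, G, hG, hFG, heq⟩
    obtain ⟨a, ha⟩ := F.nonempty
    obtain ⟨b, hb⟩ := G.nonempty
    have hab : θ a * θ b ∈ P := by
      rw [← map_mul, ← mem_comap (hθ := hθ) (hP := hP), heq]
      exact mul_mem_mul hFG ha hb
    -- The factors are chosen to contain `θ a` and `θ b`, so their pullbacks meet `F` and `G`;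
    -- comparing ranges and domains then makes them equal to `F` and `G`.
    obtain ⟨Q, R, hQR, haQ, hbR, rfl⟩ := exists_mul hab
    have hQ := hP.of_mul_left
    have hR := hP.of_mul_right
    rw [comap_mul (hP := hQ) (hQ := hR)] at heq
    have h1 : comap hθ hQ = F := by
      refine eq_of_ran_eq (a := a) ?_ haQ ha
      have h := congrArg ran heq
      rwa [ran_mul, ran_mul] at h
    have h2 : comap hθ hR = G := by
      refine eq_of_dom_eq (a := b) ?_ hbR hb
      have h := congrArg dom heq
      rwa [dom_mul, dom_mul] at h
    exact mul_mem_mul hQR ((ht Q hQ).2 (h1 ▸ hF)) ((hu R hR).2 (h2 ▸ hG))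

theorem Represents.isLUB [IsDistributive T] {ι : Type*} {I : Set ι} {t : ι → T}
    {A : ι → Set (UniversalGroupoid S)} {u : T} (ht : ∀ i ∈ I, Represents hθ (t i) (A i))
    (hu : Represents hθ u (⋃ i ∈ I, A i)) : IsLUB (t '' I) u := by
  constructor
  · rintro _ ⟨i, hi, rfl⟩
    exact (ht i hi).le hu (Set.subset_biUnion_of_mem hi)
  · intro v hv
    refine le_of_forall_isPrime fun P hP huP => ?_
    obtain ⟨i, hi, h⟩ := Set.mem_iUnion₂.1 ((hu P hP).1 huP)
    exact P.up (hv ⟨i, hi, rfl⟩) ((ht i hi P hP).2 h)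

/-- A converse to `Represents.isLUB`. Finiteness is needed here because primeness controls only
finite joins. -/
theorem Represents.of_isLUB [IsDistributive T] {ι : Type*} {I : Set ι} (hI : I.Finite) {t : ι → T}
    {A : ι → Set (UniversalGroupoid S)} {u : T} (ht : ∀ i ∈ I, Represents hθ (t i) (A i))
    (hu : IsLUB (t '' I) u) : Represents hθ u (⋃ i ∈ I, A i) := by
  intro P hP
  rw [Set.mem_iUnion₂]
  constructor
  · intro h
    obtain ⟨_, ⟨i, hi, rfl⟩, hiP⟩ := hP.exists_mem_of_isLUB (hI.image t) hu h
    exact ⟨i, hi, (ht i hi P hP).1 hiP⟩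
  · rintro ⟨i, hi, h⟩
    exact P.up (hu.1 ⟨i, hi, rfl⟩) ((ht i hi P hP).2 h)

/-- The representing element is the complement in `θ x` of the join `u` of `θ(X)`: by primeness,
omitting `u` is the same as omitting every `θ y`. -/
theorem exists_represents_basicSet [IsWeaklyBoolean T] {x : S} {X : Set S} (hX : X.Finite)
    (hx : ∀ y ∈ X, y ≤ x) : ∃ t, Represents hθ t (basicSet x X) := by
  have hb : ∀ a ∈ θ '' X, a ≤ θ x := by
    rintro _ ⟨y, hy, rfl⟩
    exact map_le θ (hx y hy)
  obtain ⟨u, hu⟩ := exists_isLUB_of_bounded (hX.image θ) hb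
  obtain ⟨t, ht⟩ := exists_relative_compl (hu.2 hb)
  refine ⟨t, fun P hP => (ht P hP).trans (and_congr Iff.rfl ?_)⟩
  constructor
  · intro h y hy hyP
    exact h (P.up (hu.1 ⟨y, hy, rfl⟩) hyP)
  · intro h huP
    obtain ⟨_, ⟨y, hy, rfl⟩, hyP⟩ := hP.exists_mem_of_isLUB (hX.image θ) hu huP
    exact h y hy hyP

theorem Represents.inv [IsDistributive T] {t : T} {A : Set (UniversalGroupoid S)} (ht : Represents hθ t A) :
    Represents hθ t⁻¹ (setInv A) := by
  intro P hP
  have h : (comap hθ hP).inv = comap hθ hP.inv := by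
    ext s
    rw [mem_inv, mem_comap, mem_comap, mem_inv, map_inv']
  rw [mem_setInv, h, ← ht _ hP.inv, mem_inv]

/-- Every prime filter containing `t⁻¹ * u` is an identity of the groupoid, so it also contains
`(t⁻¹ * u)⁻¹ * (t⁻¹ * u)`. Separation by prime filters then puts `t⁻¹ * u` below an idempotent. -/
theorem Represents.isIdempotentElem_inv_mul [IsDistributive T] {t u : T}
    {A B : Set (UniversalGroupoid S)} (ht : Represents hθ t A) (hu : Represents hθ u B)
    (h : ∀ F ∈ A, ∀ G ∈ B, F.ran = G.ran → F = G) : IsIdempotentElem (t⁻¹ * u) := by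
  refine isIdempotentElem_of_le_inv_mul (le_of_forall_isPrime fun P hP htu => ?_)
  suffices hPd : P = P.dom by
    have h1 := dom_mem_sub htu
    rwa [← hPd] at h1
  obtain ⟨Q, R, hQR, hQ, hR, rfl⟩ := exists_mul htu
  have hQp := hP.of_mul_left
  have hRp := hP.of_mul_right
  have hran : Q.inv.ran = R.ran := by rw [ran_inv, hQR]
  have htQ : t ∈ Q.inv := by
    have := inv_mem_inv hQ
    rwa [inv_inv'] at this
  obtain ⟨a, ha⟩ := (comap hθ hRp).nonempty
  have heq := h _ ((ht _ hQp.inv).1 htQ) _ ((hu R hRp).1 hR) (ran_comap_eq hran)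
  -- The pullbacks of `Q⁻¹` and `R` agree, hence both filters contain `θ a`; having the same range,
  -- they coincide, and `P = Q · Q⁻¹`.
  obtain rfl : Q.inv = R := eq_of_ran_eq (a := θ a) hran (mem_comap.1 (heq ▸ ha)) ha
  rw [mul_inv_self, dom_ran]

/-- Injectivity of the range map on `C` makes `t⁻¹ * u` idempotent; injectivity of the domain map
does the same for `t * u⁻¹` after passing to inverses. -/
theorem Represents.compatible [IsDistributive T] {t u : T} {A B C : Set (UniversalGroupoid S)}
    (ht : Represents hθ t A) (hu : Represents hθ u B) (hC : IsBisection C) (hA : A ⊆ C)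
    (hB : B ⊆ C) : Compatible t u := by
  rw [isBisection_iff] at hC
  refine ⟨ht.isIdempotentElem_inv_mul hu fun F hF G hG => hC.2 F (hA hF) G (hB hG), ?_⟩
  have h := ht.inv.isIdempotentElem_inv_mul hu.inv fun F hF G hG hFG => by
    rw [← inv_inv_eq F, ← inv_inv_eq G]
    refine congrArg UniversalGroupoid.inv
      (hC.1 _ (hA (mem_setInv.1 hF)) _ (hB (mem_setInv.1 hG)) ?_)
    rw [dom_inv, dom_inv, hFG]
  rwa [inv_inv'] at h

theorem exists_represents [IsWeaklyBoolean T] {A : Set (UniversalGroupoid S)} (hc : IsCompact A)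
    (ho : IsOpen A) (hA : IsBisection A) : ∃ t, Represents hθ t A := by
  obtain ⟨I, hI, rfl⟩ := (isCompact_isOpen_iff A).1 ⟨hc, ho⟩
  choose t ht using fun i : BasicIndex S =>
    exists_represents_basicSet (hθ := hθ) i.2.1 i.2.2
  obtain ⟨u, hu⟩ := IsDistributive.exists_isLUB (t '' I) (hI.image t) (by
    rintro _ ⟨i, hi, rfl⟩ _ ⟨j, hj, rfl⟩
    exact (ht i).compatible (ht j) hA (Set.subset_biUnion_of_mem (u := fun i : BasicIndex S =>
      basicSet i.1.1 i.1.2) hi) (Set.subset_biUnion_of_mem (u := fun i : BasicIndex S =>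
      basicSet i.1.1 i.1.2) hj))
  exact ⟨u, Represents.of_isLUB hI (fun i _ => ht i) hu⟩

end Pullback

end UniversalGroupoid

/-! ### The extension to `B(S)` and its uniqueness -/

namespace Booleanization

open InverseSemigroup UniversalGroupoid

variable {S T : Type*} [InverseSemigroup S] [InverseSemigroup T] {θ : S →ₙ* T}
  (hθ : ∀ P : Set T, IsPrimeFilter P → IsProperFilter (θ ⁻¹' P))

/-- The extension of `θ` to `B(S)`: a compact-open bisection is sent to the element of `T` that
represents it. -/
noncomputable def lift [IsWeaklyBoolean T] : DistributiveHom (Booleanization S) T :=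
  have hr (A : Booleanization S) :
      Represents hθ (exists_represents (hθ := hθ) A.isCompact A.isOpen A.isBisection).choose
        A.carrier :=
    (exists_represents A.isCompact A.isOpen A.isBisection).choose_spec
  { toFun A := (exists_represents (hθ := hθ) A.isCompact A.isOpen A.isBisection).choose
    -- The choice of representing element is harmless: both sides represent the same set, hence
    -- agree.
    map_mul' A B := (hr (A * B)).unique ((hr A).mul (hr B))
    map_isLUB _ B hfin _ h :=
      Represents.isLUB (A := carrier) (fun A _ => hr A) (carrier_of_isLUB hfin h ▸ hr B) }

theorem represents_lift [IsWeaklyBoolean T] (A : Booleanization S) :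
    Represents hθ ((lift hθ).toMulHom A) A.carrier :=
  (exists_represents A.isCompact A.isOpen A.isBisection).choose_spec

theorem mem_β {s : S} {F : UniversalGroupoid S} : F ∈ (β S s).carrier ↔ s ∈ F := Iff.rfl

theorem represents_β (s : S) : Represents hθ (θ s) (β S s).carrier := fun _ _ => Iff.rfl

/-- The basic compact-open bisection `U_{x;X}`. -/
def basic (i : BasicIndex S) : Booleanization S where
  carrier := basicSet i.1.1 i.1.2
  isCompact := isCompact_basicSet _ _
  isOpen := isOpen_basicSet i.2.1 i.2.2
  isBisection := by
    have h := isBisection_iff.1 (β S i.1.1).isBisection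
    exact isBisection_iff.2 ⟨fun F hF G hG => h.1 F hF.1 G hG.1, fun F hF G hG => h.2 F hF.1 G hG.1⟩

/-- The empty bisection is the join of the empty family, and a morphism preserves that join as well.
-/
theorem isBot_map [IsDistributive T] (φ : DistributiveHom (Booleanization S) T)
    {A : Booleanization S} (hA : A.carrier = ∅) : IsBot (φ.toMulHom A) := by
  have h := φ.map_isLUB ∅ A Set.finite_empty (by simp) (isLUB_of_carrier (by simp [hA]))
  rw [Set.image_empty, isLUB_empty_iff] at h
  exact h

/-- With `x` the first component of `i`, a product `F · G` in this set would have `y⁻¹ * y` in the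
domain of `F`, hence `y = x * (y⁻¹ * y) ∈ F`, although `F` omits `y`. -/
theorem basic_mul_β_eq_empty (i : BasicIndex S) {y : S} (hy : y ∈ i.1.2) :
    (basic i * β S (y⁻¹ * y)).carrier = ∅ := by
  refine Set.eq_empty_of_forall_notMem ?_
  rintro _ ⟨F, hF, G, hG, h, rfl⟩
  have h1 := ran_mem_sub (mem_β.1 hG)
  rw [idem_inv (idem_inv_mul y), (idem_inv_mul y).eq, ← h] at h1
  have h2 := mul_dom_mem hF.1 h1
  rw [← le_iff_right.1 (i.2.2 y hy)] at h2
  exact hF.2 y hy h2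

/-- `U_x` is the join of `U_{x;X}` and the `U_y` for `y ∈ X`, and `φ` preserves this join. A prime
filter containing `θ x` thus contains `φ(U_{x;X})` or some `θ y`, and it cannot contain both kinds.
-/
theorem represents_basic [IsDistributive T] {φ : DistributiveHom (Booleanization S) T}
    (hφ : ∀ s, φ.toMulHom (β S s) = θ s) (i : BasicIndex S) :
    Represents hθ (φ.toMulHom (basic i)) (basic i).carrier := by
  intro P hP
  have hle : ∀ A ∈ insert (basic i) (β S '' i.1.2), A ≤ β S i.1.1 := by
    rintro _ (rfl | ⟨y, hy, rfl⟩)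
    · exact le_iff.2 fun F hF => hF.1
    · exact map_le _ (i.2.2 y hy)
  have hlub : IsLUB (insert (basic i) (β S '' i.1.2)) (β S i.1.1) := by
    refine ⟨hle, fun C hC => le_iff.2 fun F hF => ?_⟩
    by_cases h : ∃ y ∈ i.1.2, y ∈ F
    · obtain ⟨y, hy, hyF⟩ := h
      exact le_iff.1 (hC (Or.inr ⟨y, hy, rfl⟩)) hyF
    · exact le_iff.1 (hC (Or.inl rfl)) ⟨hF, fun y hy hyF => h ⟨y, hy, hyF⟩⟩
  have hfin : (insert (basic i) (β S '' i.1.2)).Finite := (i.2.1.image _).insert _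
  have h1 := φ.map_isLUB _ _ hfin
    (fun A hA B hB => Compatible.of_le (hle A hA) (hle B hB)) hlub
  constructor
  · intro h
    refine ⟨?_, fun y hy hyP => ?_⟩
    · rw [mem_comap, ← hφ]
      exact P.up (map_le φ.toMulHom (hle _ (Or.inl rfl))) h
    -- The product of `φ(U_{x;X})` with `θ (y⁻¹ * y)` is the image of the empty bisection, a zero.
    · have h2 := mul_dom_mem h (dom_mem_sub (mem_comap.1 hyP))
      rw [← map_inv', ← map_mul, ← hφ, ← map_mul] at h2
      exact P.not_bot h2 (isBot_map φ (basic_mul_β_eq_empty i hy))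
  · rintro ⟨hx, hX⟩
    rw [mem_comap, ← hφ] at hx
    obtain ⟨_, ⟨_, rfl | ⟨y, hy, rfl⟩, rfl⟩, h2⟩ := hP.exists_mem_of_isLUB (hfin.image _) h1 hx
    · exact h2
    · refine absurd ?_ (hX y hy)
      rw [mem_comap, ← hφ]
      exact h2

/-- This determines `φ`, since a representing element is unique. It follows from the basic case
because `A` is a finite join of basic bisections and `φ` preserves that join. -/
theorem represents_of_comp_β [IsDistributive T] {φ : DistributiveHom (Booleanization S) T}
    (hφ : ∀ s, φ.toMulHom (β S s) = θ s) (A : Booleanization S) :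
    Represents hθ (φ.toMulHom A) A.carrier := by
  obtain ⟨I, hI, hA⟩ := (isCompact_isOpen_iff A.carrier).1 ⟨A.isCompact, A.isOpen⟩
  have hlub : IsLUB (basic '' I) A :=
    isLUB_of_carrier (by rw [hA, Set.biUnion_image]; rfl)
  have h1 := φ.map_isLUB _ _ (hI.image basic)
    (fun B hB C hC => Compatible.of_le (hlub.1 hB) (hlub.1 hC)) hlub
  rw [← Set.image_comp] at h1
  rw [hA]
  exact Represents.of_isLUB hI (fun i _ => represents_basic hθ hφ i) h1

end Booleanization

theorem theorem5p7 {S T : Type*} [InverseSemigroup S] [InverseSemigroup T] [IsWeaklyBoolean T]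
    (θ : S →ₙ* T) (hθ : ∀ P : Set T, IsPrimeFilter P → IsProperFilter (θ ⁻¹' P)) :
    ∃! θ' : DistributiveHom (Booleanization S) T,
      θ'.toMulHom.comp (Booleanization.β S) = θ := by
  refine ⟨Booleanization.lift hθ, MulHom.ext fun s => ?_, fun φ hφ => ?_⟩
  · exact (Booleanization.represents_lift hθ _).unique (Booleanization.represents_β hθ s)
  · refine DistributiveHom.ext_apply fun A => ?_
    exact (Booleanization.represents_of_comp_β hθ (fun s => DFunLike.congr_fun hφ s) A).unique
      (Booleanization.represents_lift hθ A)
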